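/- **Setting.** Two robots start at the origin of the real line and search for an exit at an unknown point $p\neq 0$; put $d=|p|$. A robot traversing an interval of length $x$ at speed $v$ uses energy $v^2x$. For $0<s<r$, $0<k$, the Two-Turn algorithm with speeds $(s,r,k)$ is: the robots walk in opposite directions at speed $s$ until one of them finds the exit; the finder turns around and walks at speed $r$ until it catches the other robot, which keeps walking away at speed $s$; then both return together to the exit at speed $k$. The search time is the first time by which both robots have reached the exit, and the energy consumption is the total energy used by the two robots. For $c,b>0$ the speeds are *feasible* if $0<s<r$, $0<k$, $s,r,k\le b$, and the search time is at most $c\,d$ for every $p\ne0$. The competitive ratio is $\sup_{p\neq 0}\frac{c^2}{2d}\cdot(\text{energy consumption for the exit at }p)$. Feasible speeds are *optimal* if, for every $p\neq0$, their energy consumption is at most that of any other feasible speeds of the Two-Turn algorithm. **Constants.** Let $\gamma_1=3+\sqrt{38}\cos\!\left(\tfrac13\arctan\tfrac{127}{151\sqrt2}\right)\approx 9.06609$. **Theorem.** The system $$r-\frac{2r(k^2+r^2)}{(r-s)^2}=2k^3\Big(\frac{2(k+r)}{k(r-s)^2}-\frac1{s^2}\Big),\qquad -2k^2s+2r^3-3r^2s-s^3=4k^2(k+s),\qquad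 \frac{2(k+r)}{k(r-s)}+\frac1s=1$$ has exactly one solution $(s,r,k)=(\sigma,\rho,\kappa)$ with $0<s<r$, $0<k$, and $\sigma\approx2.65976$, $\rho\approx11.3414$, $\kappa\approx6.63709$ (all decimals correctly rounded, as for $\gamma_1$). Let $\gamma_2=\rho$. For all $c,b>0$ with $cb\ge9$, the following speeds are feasible for the Two-Turn algorithm: * if $9\le cb\le\gamma_1$: $s=\dfrac{-\sqrt{(bc)^2-10bc+9}+bc-3}{2c}$, $r=b$, $k=b$; * if $\gamma_1<cb<\gamma_2$: $s=0.532412\,b-0.0262661\,b^2c$, $r=b$, $k=\dfrac{2bs}{bcs-b-cs^2-s}$; * if $cb\ge\gamma_2$: $s=\sigma/c$, $r=\rho/c$, $k=\kappa/c$. Their competitive ratio is $f(cb)$, so it depends only on the product $cb$, and their energy consumption for every exit at distance $d$ is $f(cb)\frac{2d}{c^2}$, where $$f(x)=\begin{cases}\frac12x\left(x\left(x-\sqrt{(x-9)(x-1)}\right)+\sqrt{(x-9)(x-1)}+3\right),&9\le x\le\gamma_1,\\[1ex] \dfrac{x^2\,(u^2+2q^2+1)}{1-u},\quad u=0.532412-0.0262661x,\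 q=\dfrac{2u}{xu-1-xu^2-u},&\gamma_1<x<\gamma_2,\\[2ex] \dfrac{\rho(2\kappa^2+\rho^2+\sigma^2)}{\rho-\sigma},&x\ge\gamma_2.\end{cases}$$ The last value is $292.370$ to within $0.0005$, and for $\gamma_1<x<\gamma_2$ the value $f(x)$ agrees, to within $0.001$, with $$\frac{x^2\left((0.532412-0.0262661x)^2+\frac{11595.8(20.2699-x)^2}{(x(x(x-2.46798)-398.916)+2221.18)^2}+1\right)}{0.0262661x+0.467588}.$$ The speeds are optimal when $cb\le\gamma_1$ and when $cb\ge\gamma_2$. When $\gamma_1<cb<\gamma_2$, their competitive ratio exceeds that of any feasible speeds $(s',r',k')$ of the Two-Turn algorithm by at most $0.03$. -/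

import Mathlib

namespace TwoTurn

noncomputable section

/-! ### Robots moving on the line -/

/-- A leg of a robot's motion: a constant signed velocity, kept for some duration. -/
structure Leg where
  velocity : ℝ
  duration : ℝ

/-- Position at time `t ≥ 0` of a robot that starts at the origin, performs the given legs one
after the other, and then stays where it is. -/
def position : List Leg → ℝ → ℝ
  | [], _ => 0
  | l :: L, t =>
      if t ≤ l.duration then l.velocity * t
      else l.velocity * l.duration + position L (t - l.duration)

/-- Energy used by a robot: the sum over its legs of (speed squared) times (length of the
interval traversed). -/
def legsEnergy (L : List Leg) : ℝ :=
  (L.map fun l => |l.velocity| ^ 2 * (|l.velocity| * l.duration)).sum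

/-! ### The algorithm with search speed `s`, chase speed `r`, return speed `k` -/

/-- The three speeds used by the algorithm. -/
@[ext]
structure Speeds where
  s : ℝ
  r : ℝ
  k : ℝ

/-- While searching, the robots walk in opposite directions at speed `s`. This is the first time
at which one of them is at the exit, which is located at `p`. -/
def foundTime (v : Speeds) (p : ℝ) : ℝ :=
  sInf {t : ℝ | 0 ≤ t ∧ (v.s * t = p ∨ -v.s * t = p)}

/-- The finder (the robot that was walking in direction `Real.sign p`) turns around at the exit
and walks at speed `r`, while the other robot keeps walking away at speed `s`. This is the time
from the discovery of the exit until they are first at the same place. -/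
def chaseTime (v : Speeds) (p : ℝ) : ℝ :=
  sInf {τ : ℝ | 0 ≤ τ ∧
    p + (-Real.sign p * v.r) * τ = (-Real.sign p * v.s) * (foundTime v p + τ)}

/-- The place where the finder catches the other robot. -/
def meetingPoint (v : Speeds) (p : ℝ) : ℝ :=
  (-Real.sign p * v.s) * (foundTime v p + chaseTime v p)

/-- The time that the robots need to walk together at speed `k` from the meeting point to the
exit. -/
def returnTime (v : Speeds) (p : ℝ) : ℝ :=
  sInf {τ : ℝ | 0 ≤ τ ∧ meetingPoint v p + (Real.sign p * v.k) * τ = p}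

/-- Motion of the robot that finds the exit located at `p`. -/
def finderLegs (v : Speeds) (p : ℝ) : List Leg :=
  [⟨Real.sign p * v.s, foundTime v p⟩,
   ⟨-Real.sign p * v.r, chaseTime v p⟩,
   ⟨Real.sign p * v.k, returnTime v p⟩]

/-- Motion of the other robot when the exit is located at `p`. -/
def otherLegs (v : Speeds) (p : ℝ) : List Leg :=
  [⟨-Real.sign p * v.s, foundTime v p + chaseTime v p⟩,
   ⟨Real.sign p * v.k, returnTime v p⟩]

/-- Search (evacuation) time for the exit located at `p`: the first time by which both robots
have reached the exit. -/
def searchTime (v : Speeds) (p : ℝ) : ℝ :=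
  sInf {t : ℝ | (∃ t₁, 0 ≤ t₁ ∧ t₁ ≤ t ∧ position (finderLegs v p) t₁ = p) ∧
    ∃ t₂, 0 ≤ t₂ ∧ t₂ ≤ t ∧ position (otherLegs v p) t₂ = p}

/-- Energy consumption for the exit located at `p`: the total energy of the two robots. -/
def energy (v : Speeds) (p : ℝ) : ℝ :=
  legsEnergy (finderLegs v p) + legsEnergy (otherLegs v p)

/-- The speeds `v` are legitimate for the algorithm (all are positive and the chase is faster than
the search), respect the speed bound `b`, and give search time at most `c * d` whenever the exit
is at distance `d > 0` from the origin. -/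
def Feasible (c b : ℝ) (v : Speeds) : Prop :=
  (0 < v.s ∧ v.s < v.r ∧ 0 < v.k) ∧ (v.s ≤ b ∧ v.r ≤ b ∧ v.k ≤ b) ∧
    ∀ p : ℝ, p ≠ 0 → searchTime v p ≤ c * |p|

/-- Competitive ratio: the supremum, over all exit locations, of the energy consumption divided
by the energy `2 * d / c ^ 2` of the best offline solution. The supremum is taken in the extended
reals. -/
def competitiveRatio (c : ℝ) (v : Speeds) : EReal :=
  ⨆ p : {p : ℝ // p ≠ 0}, ((c ^ 2 / (2 * |(p : ℝ)|) * energy v p : ℝ) : EReal)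

/-- The speeds `v` are feasible and minimize, for every instance, the energy consumption among
all feasible speeds. -/
def Optimal (c b : ℝ) (v : Speeds) : Prop :=
  Feasible c b v ∧
    ∀ w : Speeds, Feasible c b w → ∀ p : ℝ, p ≠ 0 → energy v p ≤ energy w p

/-! ### The constants -/

/-- The threshold `γ₁ ≈ 9.06609`. -/
def gamma1 : ℝ :=
  3 + Real.sqrt 38 * Real.cos (Real.arctan (127 / (151 * Real.sqrt 2)) / 3)

/-- The algebraic system whose solution with `0 < s < r`, `0 < k` is `(σ, ρ, κ)`. -/
def SigmaRhoKappaSystem (v : Speeds) : Prop :=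
  (0 < v.s ∧ v.s < v.r ∧ 0 < v.k) ∧
  v.r - 2 * v.r * (v.k ^ 2 + v.r ^ 2) / (v.r - v.s) ^ 2
    = 2 * v.k ^ 3 * (2 * (v.k + v.r) / (v.k * (v.r - v.s) ^ 2) - 1 / v.s ^ 2) ∧
  -2 * v.k ^ 2 * v.s + 2 * v.r ^ 3 - 3 * v.r ^ 2 * v.s - v.s ^ 3
    = 4 * v.k ^ 2 * (v.k + v.s) ∧
  2 * (v.k + v.r) / (v.k * (v.r - v.s)) + 1 / v.s = 1

/-! ### The choice of speeds and the induced competitive ratio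

In what follows `w` stands for the triple `(σ, ρ, κ)`, so that `γ₂ = ρ = w.r`. -/

/-- Speeds for `9 ≤ c * b ≤ γ₁`. -/
def lowSpeeds (c b : ℝ) : Speeds where
  s := (-Real.sqrt ((b * c) ^ 2 - 10 * (b * c) + 9) + b * c - 3) / (2 * c)
  r := b
  k := b

/-- Search speed for `γ₁ < c * b < γ₂`. -/
def midS (c b : ℝ) : ℝ := 0.532412 * b - 0.0262661 * b ^ 2 * c

/-- Speeds for `γ₁ < c * b < γ₂`. -/
def midSpeeds (c b : ℝ) : Speeds where
  s := midS c b
  r := b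
  k := 2 * b * midS c b / (b * c * midS c b - b - c * midS c b ^ 2 - midS c b)

/-- Speeds for `c * b ≥ γ₂`. -/
def highSpeeds (w : Speeds) (c : ℝ) : Speeds where
  s := w.s / c
  r := w.r / c
  k := w.k / c

/-- The chosen speeds, in the three regimes. -/
def chosenSpeeds (w : Speeds) (c b : ℝ) : Speeds :=
  if c * b ≤ gamma1 then lowSpeeds c b
  else if c * b < w.r then midSpeeds c b
  else highSpeeds w c

/-- The competitive ratio for `9 ≤ x ≤ γ₁`. -/
def lowRatio (x : ℝ) : ℝ :=
  1 / 2 * x * (x * (x - Real.sqrt ((x - 9) * (x - 1))) + Real.sqrt ((x - 9) * (x - 1)) + 3)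

/-- The ratio of the search speed to `b` for `γ₁ < x < γ₂`. -/
def midSigma (x : ℝ) : ℝ := 0.532412 - 0.0262661 * x

/-- The ratio of the return speed to `b` for `γ₁ < x < γ₂`. -/
def midKappa (x : ℝ) : ℝ :=
  2 * midSigma x / (x * midSigma x - 1 - x * midSigma x ^ 2 - midSigma x)

/-- The competitive ratio for `γ₁ < x < γ₂`, without rounding. -/
def midRatio (x : ℝ) : ℝ :=
  x ^ 2 * (midSigma x ^ 2 + 2 * midKappa x ^ 2 + 1) / (1 - midSigma x)

/-- The competitive ratio for `γ₁ < x < γ₂`, expanded, with coefficients rounded to six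
significant digits. -/
def midRatioRounded (x : ℝ) : ℝ :=
  x ^ 2 * ((0.532412 - 0.0262661 * x) ^ 2
      + 11595.8 * (20.2699 - x) ^ 2 / (x * (x * (x - 2.46798) - 398.916) + 2221.18) ^ 2 + 1)
    / (0.0262661 * x + 0.467588)

/-- The competitive ratio for `x ≥ γ₂`. -/
def highRatio (w : Speeds) : ℝ :=
  w.r * (2 * w.k ^ 2 + w.r ^ 2 + w.s ^ 2) / (w.r - w.s)

/-- The function `f` of `x = c * b`. -/
def ratioFun (w : Speeds) (x : ℝ) : ℝ :=
  if x ≤ gamma1 then lowRatio x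
  else if x < w.r then midRatio x
  else highRatio w

end

end TwoTurn

/-!
A speed triple enters the problem only through two functions: the search time per unit of distance,
`timeRate s r k = 1 / s + 2 / (r - s) + 2 * r / (k * (r - s))`, and half of the energy per unit of
distance, `energyRate s r k = r * (s ^ 2 + r ^ 2 + 2 * k ^ 2) / (r - s)`. Multiplying all speeds by
`c` normalizes the bound on the search time to `1` and the bound on the speeds to `x = c * b`
(`feasible_iff_scale`), so that the task is to minimize `energyRate` under `timeRate ≤ 1` and
`s, r, k ≤ x`.

Since `1 / (r - s)` is a power series in `s / r` with nonnegative coefficients, the logarithms of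
both functions are convex in `log s`, `log r`, `log k`. The tangent inequalities that express this
(`energySlope_le`, `timeSlope_le`) follow from the log-sum inequality. Consequently the
Karush–Kuhn–Tucker conditions are sufficient for optimality (`energyRate_le_of_kkt`).

* With inactive speed bounds the conditions are the system for `σ`, `ρ`, `κ`. In the ratios
  `u = s / r` and `q = k / r` it is linear in `q ^ 2` and `q ^ 3`; eliminating `q` leaves an
  equation between a decreasing and an increasing function of `u`, which has exactly one root
  (`RatioSystem.unique`, `exists_ratioSystem_bounds`).
* With `r = k = x` the conditions hold as long as the multiplier of the bound on `k` is
  nonnegative. This is a cubic inequality in `u`, and it holds precisely for `x ≤ γ₁`, because `γ₁`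
  is the root of a related cubic (`le_gamma1_iff`, `energyRate_lowS_le`).
* In the middle regime only the bound on `r` is active. Geometric interpolation towards
  `(σ, ρ, κ)` shows that one may take `r = x` (`exists_interpolation`). For fixed `x` the time
  constraint bounds `1 / q` by a function of `u`; replacing `q ^ 2`, `1 / u` and `u ^ 2` by tangents
  at nearly optimal points gives an explicit lower bound of the energy. It is compared with the
  chosen speeds by polynomial inequalities in `x` alone, which are proved by expansion in the
  Bernstein basis (`MidCertificate`, `midRatio_le_of_r_eq`).
-/

namespace TwoTurn

/-! ### Search time and energy in closed form -/

/-- The search time per unit of distance, for speeds `s < r` and `k`. -/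
noncomputable def timeRate (s r k : ℝ) : ℝ := 1 / s + 2 / (r - s) + 2 * r / (k * (r - s))

/-- Half of the energy consumption per unit of distance, for speeds `s < r` and `k`. -/
noncomputable def energyRate (s r k : ℝ) : ℝ := r * (s ^ 2 + r ^ 2 + 2 * k ^ 2) / (r - s)

/-- The sign conditions under which speeds are legitimate. -/
def Valid (v : Speeds) : Prop := 0 < v.s ∧ v.s < v.r ∧ 0 < v.k

lemma sign_mul_sign {p : ℝ} (hp : p ≠ 0) : Real.sign p * Real.sign p = 1 := by
  rcases lt_or_gt_of_ne hp with h | h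
  · simp [Real.sign_of_neg h]
  · simp [Real.sign_of_pos h]

lemma eq_sign_mul_abs (p : ℝ) : p = Real.sign p * |p| := by
  rcases lt_trichotomy p 0 with h | h | h
  · simp [Real.sign_of_neg h, abs_of_neg h]
  · simp [h]
  · simp [Real.sign_of_pos h, abs_of_pos h]

lemma abs_sign {p : ℝ} (hp : p ≠ 0) : |Real.sign p| = 1 := by
  rcases lt_or_gt_of_ne hp with h | h
  · simp [Real.sign_of_neg h]
  · simp [Real.sign_of_pos h]

/-- Multiplying by the sign reduces an equation between positions to one on the positive side. -/
lemma sign_mul_eq_iff {p x : ℝ} (hp : p ≠ 0) : Real.sign p * x = p ↔ x = |p| := by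
  have h1 := sign_mul_sign hp
  have h2 := eq_sign_mul_abs p
  have h0 : Real.sign p ≠ 0 := by
    intro h
    simp [h] at h1
  constructor
  · intro h
    rw [h2] at h
    simp only [← h2] at h
    exact mul_left_cancel₀ h0 (h.trans h2)
  · rintro rfl
    exact h2.symm

lemma foundTime_eq {v : Speeds} (hv : Valid v) (p : ℝ) :
    foundTime v p = |p| / v.s := by
  obtain ⟨hs, -, -⟩ := hv
  have : {t : ℝ | 0 ≤ t ∧ (v.s * t = p ∨ -v.s * t = p)} = {|p| / v.s} := by
    ext t
    simp only [Set.mem_ofPred_eq, Set.mem_singleton_iff, eq_div_iff hs.ne']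
    constructor
    · rintro ⟨ht, h | h⟩
      · rw [← h, abs_of_nonneg (by positivity)]; ring
      · rw [← h, neg_mul, abs_neg, abs_of_nonneg (by positivity)]; ring
    · intro h
      refine ⟨?_, ?_⟩
      · have := abs_nonneg p
        by_contra! hlt
        nlinarith
      · rcases abs_choice p with h' | h'
        · left; linarith
        · right; linarith
  rw [foundTime, this, csInf_singleton]

lemma chaseTime_eq {v : Speeds} (hv : Valid v) {p : ℝ} (hp : p ≠ 0) :
    chaseTime v p = 2 * |p| / (v.r - v.s) := by
  have hf := foundTime_eq hv p
  obtain ⟨hs, hr, -⟩ := hv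
  have hrs : 0 < v.r - v.s := by linarith
  have hd := abs_pos.2 hp
  have hsf : v.s * foundTime v p = |p| := by rw [hf]; field_simp
  have : {τ : ℝ | 0 ≤ τ ∧
      p + (-Real.sign p * v.r) * τ = (-Real.sign p * v.s) * (foundTime v p + τ)}
      = {2 * |p| / (v.r - v.s)} := by
    ext t
    simp only [Set.mem_ofPred_eq, Set.mem_singleton_iff, eq_div_iff hrs.ne']
    have key : p + (-Real.sign p * v.r) * t = (-Real.sign p * v.s) * (foundTime v p + t) ↔
        t * (v.r - v.s) = 2 * |p| := by
      have : (p + (-Real.sign p * v.r) * t = (-Real.sign p * v.s) * (foundTime v p + t)) ↔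
          Real.sign p * (v.r * t - v.s * (foundTime v p + t)) = p := by
        constructor <;> intro h <;> linarith
      rw [this, sign_mul_eq_iff hp]
      constructor <;> intro h <;> linarith
    rw [key]
    refine ⟨fun h => h.2, fun h => ⟨?_, h⟩⟩
    by_contra! hlt
    nlinarith
  rw [chaseTime, this, csInf_singleton]

/-- The other robot's distance from the origin when it is caught. -/
lemma speed_mul_catch {v : Speeds} (hv : Valid v) {p : ℝ} (hp : p ≠ 0) :
    v.s * (foundTime v p + chaseTime v p) = |p| * (v.r + v.s) / (v.r - v.s) := by
  rw [foundTime_eq hv p, chaseTime_eq hv hp]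
  obtain ⟨hs, hr, -⟩ := hv
  have hrs : v.r - v.s ≠ 0 := by linarith
  field_simp
  ring

lemma returnTime_eq {v : Speeds} (hv : Valid v) {p : ℝ} (hp : p ≠ 0) :
    returnTime v p = 2 * |p| * v.r / (v.k * (v.r - v.s)) := by
  have hc := speed_mul_catch hv hp
  obtain ⟨hs, hr, hk⟩ := hv
  have hrs : 0 < v.r - v.s := by linarith
  have hd := abs_pos.2 hp
  have : {τ : ℝ | 0 ≤ τ ∧ meetingPoint v p + (Real.sign p * v.k) * τ = p}
      = {2 * |p| * v.r / (v.k * (v.r - v.s))} := by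
    ext t
    simp only [Set.mem_ofPred_eq, Set.mem_singleton_iff]
    have key : meetingPoint v p + (Real.sign p * v.k) * t = p ↔
        t = 2 * |p| * v.r / (v.k * (v.r - v.s)) := by
      have : meetingPoint v p + (Real.sign p * v.k) * t
          = Real.sign p * (v.k * t - v.s * (foundTime v p + chaseTime v p)) := by
        rw [meetingPoint]; ring
      rw [this, sign_mul_eq_iff hp, hc, eq_div_iff (by positivity), sub_eq_iff_eq_add,
        ← sub_eq_zero, ← sub_eq_zero (a := t * _)]
      have : v.k * t - (|p| + |p| * (v.r + v.s) / (v.r - v.s))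
          = (t * (v.k * (v.r - v.s)) - 2 * |p| * v.r) / (v.r - v.s) := by
        field_simp
        ring
      rw [this, div_eq_zero_iff]
      simp [hrs.ne']
    rw [key]
    refine ⟨fun h => h.2, fun h => ⟨?_, h⟩⟩
    have : 0 < v.r := by linarith
    rw [h]
    positivity
  rw [returnTime, this, csInf_singleton]

/-- The robot that does not find the exit moves away from it until it is caught, so that the
search ends exactly when the common walk back ends. -/
lemma searchTime_eq {v : Speeds} (hv : Valid v) {p : ℝ} (hp : p ≠ 0) :
    searchTime v p = timeRate v.s v.r v.k * |p| := by
  have hf := foundTime_eq hv p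
  have hch := chaseTime_eq hv hp
  have hre := returnTime_eq hv hp
  have hc := speed_mul_catch hv hp
  obtain ⟨hs, hr, hk⟩ := hv
  have hrs : 0 < v.r - v.s := by linarith
  have hr0 : 0 < v.r := by linarith
  have hd := abs_pos.2 hp
  have hf0 : 0 < foundTime v p := by rw [hf]; positivity
  have hch0 : 0 < chaseTime v p := by rw [hch]; positivity
  have hre0 : 0 < returnTime v p := by rw [hre]; positivity
  have htot : timeRate v.s v.r v.k * |p|
      = foundTime v p + chaseTime v p + returnTime v p := by
    rw [hf, hch, hre, timeRate]
    ring
  have hret : v.k * returnTime v p - v.s * (foundTime v p + chaseTime v p) = |p| := by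
    rw [hc, hre]
    field_simp
    ring
  have hleast : IsLeast {t : ℝ | (∃ t₁, 0 ≤ t₁ ∧ t₁ ≤ t ∧ position (finderLegs v p) t₁ = p) ∧
      ∃ t₂, 0 ≤ t₂ ∧ t₂ ≤ t ∧ position (otherLegs v p) t₂ = p}
      (foundTime v p + chaseTime v p + returnTime v p) := by
    constructor
    · refine ⟨⟨foundTime v p, hf0.le, by linarith, ?_⟩, _, by positivity, le_rfl, ?_⟩
      · rw [finderLegs, position, if_pos le_rfl, mul_assoc, sign_mul_eq_iff hp, hf]
        field_simp
      · rw [otherLegs, position, if_neg (by simpa using hre0), position,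
          if_pos (by simp)]
        have : -Real.sign p * v.s * (foundTime v p + chaseTime v p)
            + Real.sign p * v.k * (foundTime v p + chaseTime v p + returnTime v p
              - (foundTime v p + chaseTime v p))
            = Real.sign p * (v.k * returnTime v p - v.s * (foundTime v p + chaseTime v p)) := by
          ring
        rw [this, sign_mul_eq_iff hp, hret]
    · rintro t ⟨-, t₂, h0, ht, hpos⟩
      refine le_trans ?_ ht
      rw [otherLegs, position] at hpos
      split_ifs at hpos with h1
      · have : Real.sign p * (-(v.s * t₂)) = p := by
          simp only at hpos
          linarith
        rw [sign_mul_eq_iff hp] at this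
        nlinarith [mul_nonneg hs.le h0]
      · rw [position] at hpos
        split_ifs at hpos with h2
        · have : Real.sign p * (v.k * (t₂ - (foundTime v p + chaseTime v p))
              - v.s * (foundTime v p + chaseTime v p)) = p := by
            simp only at hpos
            linarith
          rw [sign_mul_eq_iff hp, ← hret] at this
          have := mul_left_cancel₀ hk.ne' (sub_left_injective this)
          linarith
        · simp only [not_le] at h2
          linarith
  rw [htot, searchTime, hleast.csInf_eq]

lemma energy_eq {v : Speeds} (hv : Valid v) {p : ℝ} (hp : p ≠ 0) :
    energy v p = 2 * energyRate v.s v.r v.k * |p| := by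
  have hf := foundTime_eq hv p
  have hch := chaseTime_eq hv hp
  have hre := returnTime_eq hv hp
  obtain ⟨hs, hr, hk⟩ := hv
  have hrs : v.r - v.s ≠ 0 := by linarith
  have hr0 : 0 < v.r := by linarith
  simp only [energy, finderLegs, otherLegs, legsEnergy, List.map_cons, List.map_nil,
    List.sum_cons, List.sum_nil, abs_mul, abs_neg, abs_sign hp, one_mul, abs_of_pos hs,
    abs_of_pos hk, abs_of_pos hr0, hf, hch, hre, energyRate]
  field_simp
  ring

lemma feasible_iff {c b : ℝ} {v : Speeds} :
    Feasible c b v ↔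
      Valid v ∧ (v.s ≤ b ∧ v.r ≤ b ∧ v.k ≤ b) ∧ timeRate v.s v.r v.k ≤ c := by
  constructor
  · rintro ⟨hv, hb, h⟩
    refine ⟨hv, hb, ?_⟩
    have := h 1 one_ne_zero
    rw [searchTime_eq hv one_ne_zero] at this
    simpa using this
  · rintro ⟨hv, hb, h⟩
    refine ⟨hv, hb, fun p hp => ?_⟩
    rw [searchTime_eq hv hp]
    exact mul_le_mul_of_nonneg_right h (abs_nonneg p)

lemma competitiveRatio_eq {c : ℝ} {v : Speeds} (hv : Valid v) :
    competitiveRatio c v = ((c ^ 2 * energyRate v.s v.r v.k : ℝ) : EReal) := by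
  have h : ∀ p : {p : ℝ // p ≠ 0}, c ^ 2 / (2 * |(p : ℝ)|) * energy v p
      = c ^ 2 * energyRate v.s v.r v.k := by
    rintro ⟨p, hp⟩
    have := abs_pos.2 hp
    rw [energy_eq hv hp]
    field_simp
  have : Nonempty {p : ℝ // p ≠ 0} := ⟨⟨1, one_ne_zero⟩⟩
  simp only [competitiveRatio, h, ciSup_const]

/-! ### Scaling -/

lemma timeRate_scale {c : ℝ} (hc : 0 < c) (s r k : ℝ) :
    timeRate (c * s) (c * r) (c * k) = timeRate s r k / c := by
  have h1 : 2 / (c * r - c * s) = 2 / (r - s) / c := by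
    rw [← mul_sub, div_div, mul_comm c]
  have h2 : 2 * (c * r) / (c * k * (c * r - c * s)) = 2 * r / (k * (r - s)) / c := by
    rw [← mul_sub, show c * k * (c * (r - s)) = c * (k * (r - s) * c) by ring,
      show 2 * (c * r) = c * (2 * r) by ring, mul_div_mul_left _ _ hc.ne', div_div]
  rw [timeRate, timeRate, h1, h2, add_div, add_div, div_div 1 s c, mul_comm c s]

lemma energyRate_scale {c : ℝ} (hc : 0 < c) (s r k : ℝ) :
    energyRate (c * s) (c * r) (c * k) = c ^ 2 * energyRate s r k := by
  rw [energyRate, energyRate, ← mul_sub, ← mul_div_assoc,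
    show c * r * ((c * s) ^ 2 + (c * r) ^ 2 + 2 * (c * k) ^ 2)
      = c * (c ^ 2 * (r * (s ^ 2 + r ^ 2 + 2 * k ^ 2))) by ring, mul_div_mul_left _ _ hc.ne']

/-! ### Logarithmic convexity of the search time and of the energy -/

/-- The log-sum inequality for two terms. -/
lemma log_sum_two {a b a₀ b₀ : ℝ} (ha : 0 < a) (hb : 0 < b) (ha₀ : 0 < a₀) (hb₀ : 0 < b₀) :
    a₀ * Real.log (a / a₀) + b₀ * Real.log (b / b₀)
      ≤ (a₀ + b₀) * Real.log ((a + b) / (a₀ + b₀)) := by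
  -- `log y ≤ y - 1` for `y = (x / x₀) / ((a + b) / (a₀ + b₀))`
  have key : ∀ x x₀ : ℝ, 0 < x → 0 < x₀ → x₀ * Real.log (x / x₀)
      ≤ x₀ * Real.log ((a + b) / (a₀ + b₀)) + (x * ((a₀ + b₀) / (a + b)) - x₀) := by
    intro x x₀ hx hx₀
    have h := Real.log_le_sub_one_of_pos (x := (x / x₀) / ((a + b) / (a₀ + b₀))) (by positivity)
    rw [Real.log_div (by positivity) (by positivity)] at h
    have h2 := mul_le_mul_of_nonneg_left h hx₀.le
    have h3 : x₀ * ((x / x₀) / ((a + b) / (a₀ + b₀)) - 1)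
        = x * ((a₀ + b₀) / (a + b)) - x₀ := by
      field_simp
    linarith
  have h1 := key a a₀ ha ha₀
  have h2 := key b b₀ hb hb₀
  have h3 : a * ((a₀ + b₀) / (a + b)) + b * ((a₀ + b₀) / (a + b)) = a₀ + b₀ := by
    field_simp
  linarith

/-- The log-sum inequality for three terms. -/
lemma log_sum_three {a b c a₀ b₀ c₀ : ℝ} (ha : 0 < a) (hb : 0 < b) (hc : 0 < c) (ha₀ : 0 < a₀)
    (hb₀ : 0 < b₀) (hc₀ : 0 < c₀) :
    a₀ * Real.log (a / a₀) + b₀ * Real.log (b / b₀) + c₀ * Real.log (c / c₀)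
      ≤ (a₀ + b₀ + c₀) * Real.log ((a + b + c) / (a₀ + b₀ + c₀)) := by
  have h1 := log_sum_two ha hb ha₀ hb₀
  have h2 := log_sum_two (add_pos ha hb) hc (add_pos ha₀ hb₀) hc₀
  linarith

lemma Valid.r_pos {v : Speeds} (hv : Valid v) : 0 < v.r := hv.1.trans hv.2.1

lemma timeRate_pos {v : Speeds} (hv : Valid v) : 0 < timeRate v.s v.r v.k := by
  have hr := hv.r_pos
  obtain ⟨h1, h2, h3⟩ := hv
  have : 0 < v.r - v.s := by linarith
  rw [timeRate]
  positivity

lemma energyRate_pos {v : Speeds} (hv : Valid v) : 0 < energyRate v.s v.r v.k := by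
  have hr := hv.r_pos
  obtain ⟨h1, h2, h3⟩ := hv
  have : 0 < v.r - v.s := by linarith
  rw [energyRate]
  positivity

/-- The function `log (r - s)` lies below its tangents in the variables `log s`, `log r`. -/
lemma log_sub_le {v v₀ : Speeds} (hv : Valid v) (hv₀ : Valid v₀) :
    Real.log ((v.r - v.s) / (v₀.r - v₀.s)) ≤
      v₀.r / (v₀.r - v₀.s) * Real.log (v.r / v₀.r)
        - v₀.s / (v₀.r - v₀.s) * Real.log (v.s / v₀.s) := by
  obtain ⟨h1, h2, -⟩ := hv
  obtain ⟨g1, g2, -⟩ := hv₀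
  have hg : 0 < v₀.r - v₀.s := by linarith
  have h := log_sum_two (sub_pos.2 h2) h1 (sub_pos.2 g2) g1
  simp only [sub_add_cancel] at h
  rw [div_mul_eq_mul_div, div_mul_eq_mul_div, ← sub_div, le_div_iff₀ hg]
  linarith

/-- The derivatives of `log (energyRate s r k)` with respect to `log s`, `log r`, `log k`. -/
noncomputable def energySlope (v : Speeds) : Speeds where
  s := 2 * v.s ^ 2 / (v.s ^ 2 + v.r ^ 2 + 2 * v.k ^ 2) + v.s / (v.r - v.s)
  r := 1 + 2 * v.r ^ 2 / (v.s ^ 2 + v.r ^ 2 + 2 * v.k ^ 2) - v.r / (v.r - v.s)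
  k := 4 * v.k ^ 2 / (v.s ^ 2 + v.r ^ 2 + 2 * v.k ^ 2)

/-- The derivatives of `timeRate s r k` with respect to `log s`, `log r`, `log k`. -/
noncomputable def timeSlope (v : Speeds) : Speeds where
  s := -(1 / v.s) + (2 / (v.r - v.s) + 2 * v.r / (v.k * (v.r - v.s))) * (v.s / (v.r - v.s))
  r := 2 * v.r / (v.k * (v.r - v.s))
    - (2 / (v.r - v.s) + 2 * v.r / (v.k * (v.r - v.s))) * (v.r / (v.r - v.s))
  k := -(2 * v.r / (v.k * (v.r - v.s)))

/-- `log (energyRate s r k)` lies above its tangents in the variables `log s`, `log r`, `log k`. -/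
lemma energySlope_le {v v₀ : Speeds} (hv : Valid v) (hv₀ : Valid v₀) :
    (energySlope v₀).s * Real.log (v.s / v₀.s) + (energySlope v₀).r * Real.log (v.r / v₀.r)
        + (energySlope v₀).k * Real.log (v.k / v₀.k)
      ≤ Real.log (energyRate v.s v.r v.k / energyRate v₀.s v₀.r v₀.k) := by
  have hG := log_sub_le hv hv₀
  have hr := hv.r_pos
  have gr := hv₀.r_pos
  obtain ⟨hs, hsr, hk⟩ := hv
  obtain ⟨gs, gsr, gk⟩ := hv₀
  have hd : 0 < v.r - v.s := by linarith
  have gd : 0 < v₀.r - v₀.s := by linarith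
  have hQ : 0 < v.s ^ 2 + v.r ^ 2 + 2 * v.k ^ 2 := by positivity
  have gQ : 0 < v₀.s ^ 2 + v₀.r ^ 2 + 2 * v₀.k ^ 2 := by positivity
  have hq := log_sum_three (a := v.s ^ 2) (b := v.r ^ 2) (c := 2 * v.k ^ 2) (a₀ := v₀.s ^ 2)
    (b₀ := v₀.r ^ 2) (c₀ := 2 * v₀.k ^ 2) (by positivity) (by positivity) (by positivity)
    (by positivity) (by positivity) (by positivity)
  rw [mul_div_mul_left _ _ two_ne_zero, ← div_pow, ← div_pow, ← div_pow, Real.log_pow,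
    Real.log_pow, Real.log_pow] at hq
  have hq' : 2 * v₀.s ^ 2 / (v₀.s ^ 2 + v₀.r ^ 2 + 2 * v₀.k ^ 2) * Real.log (v.s / v₀.s)
      + 2 * v₀.r ^ 2 / (v₀.s ^ 2 + v₀.r ^ 2 + 2 * v₀.k ^ 2) * Real.log (v.r / v₀.r)
      + 4 * v₀.k ^ 2 / (v₀.s ^ 2 + v₀.r ^ 2 + 2 * v₀.k ^ 2) * Real.log (v.k / v₀.k)
      ≤ Real.log ((v.s ^ 2 + v.r ^ 2 + 2 * v.k ^ 2) / (v₀.s ^ 2 + v₀.r ^ 2 + 2 * v₀.k ^ 2)) := by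
    rw [div_mul_eq_mul_div, div_mul_eq_mul_div, div_mul_eq_mul_div, ← add_div, ← add_div,
      div_le_iff₀ gQ]
    push_cast at hq
    linarith
  have hE : energyRate v.s v.r v.k / energyRate v₀.s v₀.r v₀.k
      = v.r / v₀.r * ((v.s ^ 2 + v.r ^ 2 + 2 * v.k ^ 2)
          / (v₀.s ^ 2 + v₀.r ^ 2 + 2 * v₀.k ^ 2)) / ((v.r - v.s) / (v₀.r - v₀.s)) := by
    rw [energyRate, energyRate]
    field_simp
  rw [hE, Real.log_div (mul_pos (div_pos hr gr) (div_pos hQ gQ)).ne' (div_pos hd gd).ne',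
    Real.log_mul (div_pos hr gr).ne' (div_pos hQ gQ).ne']
  simp only [energySlope]
  linarith

/-- `log (timeRate s r k)` lies above its tangents in the variables `log s`, `log r`, `log k`. -/
lemma timeSlope_le {v v₀ : Speeds} (hv : Valid v) (hv₀ : Valid v₀) :
    (timeSlope v₀).s * Real.log (v.s / v₀.s) + (timeSlope v₀).r * Real.log (v.r / v₀.r)
        + (timeSlope v₀).k * Real.log (v.k / v₀.k)
      ≤ timeRate v₀.s v₀.r v₀.k
        * Real.log (timeRate v.s v.r v.k / timeRate v₀.s v₀.r v₀.k) := by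
  have hG := log_sub_le hv hv₀
  have hr := hv.r_pos
  have gr := hv₀.r_pos
  obtain ⟨hs, hsr, hk⟩ := hv
  obtain ⟨gs, gsr, gk⟩ := hv₀
  have hd : 0 < v.r - v.s := by linarith
  have gd : 0 < v₀.r - v₀.s := by linarith
  have hq := log_sum_three (a := 1 / v.s) (b := 2 / (v.r - v.s))
    (c := 2 * v.r / (v.k * (v.r - v.s))) (a₀ := 1 / v₀.s) (b₀ := 2 / (v₀.r - v₀.s))
    (c₀ := 2 * v₀.r / (v₀.k * (v₀.r - v₀.s))) (by positivity) (by positivity) (by positivity)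
    (by positivity) (by positivity) (by positivity)
  have e1 : 1 / v.s / (1 / v₀.s) = (v.s / v₀.s)⁻¹ := by field_simp
  have e2 : 2 / (v.r - v.s) / (2 / (v₀.r - v₀.s)) = ((v.r - v.s) / (v₀.r - v₀.s))⁻¹ := by
    field_simp
  have e3 : 2 * v.r / (v.k * (v.r - v.s)) / (2 * v₀.r / (v₀.k * (v₀.r - v₀.s)))
      = v.r / v₀.r / (v.k / v₀.k * ((v.r - v.s) / (v₀.r - v₀.s))) := by field_simp
  rw [e1, e2, e3, Real.log_inv, Real.log_inv,
    Real.log_div (div_pos hr gr).ne' (mul_pos (div_pos hk gk) (div_pos hd gd)).ne',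
    Real.log_mul (div_pos hk gk).ne' (div_pos hd gd).ne'] at hq
  have hc : 0 ≤ 2 / (v₀.r - v₀.s) + 2 * v₀.r / (v₀.k * (v₀.r - v₀.s)) := by positivity
  have hm := mul_le_mul_of_nonneg_left hG hc
  simp only [timeRate, timeSlope]
  linarith

/-- The Karush–Kuhn–Tucker conditions are sufficient for optimality: `l` is the multiplier of the
constraint on the search time, `mr` and `mk` are those of the speed bounds. -/
lemma energyRate_le_of_kkt {v v₀ : Speeds} (hv : Valid v) (hv₀ : Valid v₀)
    (ht₀ : timeRate v₀.s v₀.r v₀.k = 1) (ht : timeRate v.s v.r v.k ≤ 1) {l mr mk : ℝ}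
    (hl : 0 ≤ l) (hs : (energySlope v₀).s + l * (timeSlope v₀).s = 0)
    (hr : (energySlope v₀).r + l * (timeSlope v₀).r = -mr)
    (hk : (energySlope v₀).k + l * (timeSlope v₀).k = -mk)
    (hmr : mr * Real.log (v.r / v₀.r) ≤ 0) (hmk : mk * Real.log (v.k / v₀.k) ≤ 0) :
    energyRate v₀.s v₀.r v₀.k ≤ energyRate v.s v.r v.k := by
  have h1 := energySlope_le hv hv₀
  have h2 := timeSlope_le hv hv₀
  rw [ht₀, div_one, one_mul] at h2
  have h3 := Real.log_nonpos (timeRate_pos hv).le ht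
  have h4 := mul_le_mul_of_nonneg_left (h2.trans h3) hl
  have h5 : 0 ≤ Real.log (energyRate v.s v.r v.k / energyRate v₀.s v₀.r v₀.k) := by
    linear_combination h1 + h4 + hmr + hmk - Real.log (v.s / v₀.s) * hs
      - Real.log (v.r / v₀.r) * hr - Real.log (v.k / v₀.k) * hk
  have hE := energyRate_pos hv
  have hE₀ := energyRate_pos hv₀
  rw [← one_le_div hE₀]
  by_contra! hlt
  exact absurd h5 (not_le.2 (Real.log_neg (by positivity) hlt))

/-- Along the geometric interpolation between two triples of speeds that both meet the time
constraint, the constraint stays met and the energy is at most the larger of the two energies.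
The interpolation can be stopped at any chase speed between the two given ones. -/
lemma exists_interpolation {v w : Speeds} (hv : Valid v) (hw : Valid w)
    (htv : timeRate v.s v.r v.k ≤ 1) (htw : timeRate w.s w.r w.k ≤ 1)
    (hE : energyRate w.s w.r w.k ≤ energyRate v.s v.r v.k) {x : ℝ} (hx : v.r ≤ x)
    (hxw : x < w.r) :
    ∃ z : Speeds, Valid z ∧ z.r = x ∧ timeRate z.s z.r z.k ≤ 1 ∧
      energyRate z.s z.r z.k ≤ energyRate v.s v.r v.k := by
  have hvr := hv.r_pos
  have hwr := hw.r_pos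
  have hx0 : 0 < x := hvr.trans_le hx
  have hlog : Real.log v.r < Real.log w.r := Real.log_lt_log hvr (hx.trans_lt hxw)
  have hlx : Real.log v.r ≤ Real.log x := Real.log_le_log hvr hx
  have hlxw : Real.log x ≤ Real.log w.r := Real.log_le_log hx0 hxw.le
  obtain ⟨t, ht0, ht1, htx⟩ : ∃ t : ℝ, 0 ≤ t ∧ t ≤ 1 ∧
      Real.log x = (1 - t) * Real.log v.r + t * Real.log w.r := by
    have hpos : 0 < Real.log w.r - Real.log v.r := sub_pos.2 hlog
    refine ⟨(Real.log x - Real.log v.r) / (Real.log w.r - Real.log v.r),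
      div_nonneg (sub_nonneg.2 hlx) hpos.le, (div_le_one hpos).2 (by linarith), ?_⟩
    field_simp
    ring
  set z : Speeds := ⟨Real.exp ((1 - t) * Real.log v.s + t * Real.log w.s), x,
    Real.exp ((1 - t) * Real.log v.k + t * Real.log w.k)⟩ with hz
  have hlogs : Real.log z.s = (1 - t) * Real.log v.s + t * Real.log w.s := Real.log_exp _
  have hlogk : Real.log z.k = (1 - t) * Real.log v.k + t * Real.log w.k := Real.log_exp _
  have hlogr : Real.log z.r = (1 - t) * Real.log v.r + t * Real.log w.r := htx
  have hzv : Valid z := by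
    refine ⟨Real.exp_pos _, ?_, Real.exp_pos _⟩
    have h1 := Real.log_lt_log hv.1 hv.2.1
    have h2 := Real.log_lt_log hw.1 hw.2.1
    rw [← Real.log_lt_log_iff (Real.exp_pos _) hx0]
    change Real.log z.s < Real.log z.r
    rw [hlogs, hlogr]
    rcases ht0.eq_or_lt with rfl | ht0
    · linarith
    · nlinarith
  have hzr : 0 < z.r := hzv.r_pos
  -- The tangents at `z`, averaged over the two end points, cancel.
  have average : ∀ (a b c F G : ℝ),
      a * Real.log (v.s / z.s) + b * Real.log (v.r / z.r) + c * Real.log (v.k / z.k) ≤ F →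
      a * Real.log (w.s / z.s) + b * Real.log (w.r / z.r) + c * Real.log (w.k / z.k) ≤ G →
      0 ≤ (1 - t) * F + t * G := by
    intro a b c F G h1 h2
    rw [Real.log_div hv.1.ne' hzv.1.ne', Real.log_div hvr.ne' hzr.ne',
      Real.log_div hv.2.2.ne' hzv.2.2.ne', hlogs, hlogr, hlogk] at h1
    rw [Real.log_div hw.1.ne' hzv.1.ne', Real.log_div hwr.ne' hzr.ne',
      Real.log_div hw.2.2.ne' hzv.2.2.ne', hlogs, hlogr, hlogk] at h2
    have h3 := mul_le_mul_of_nonneg_left h1 (sub_nonneg.2 ht1)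
    have h4 := mul_le_mul_of_nonneg_left h2 ht0
    linarith
  refine ⟨z, hzv, rfl, ?_, ?_⟩
  · have hzt := timeRate_pos hzv
    have h := average _ _ _ _ _ (timeSlope_le hv hzv) (timeSlope_le hw hzv)
    by_contra! hlt
    have neg : ∀ y : Speeds, Valid y → timeRate y.s y.r y.k ≤ 1 →
        Real.log (timeRate y.s y.r y.k / timeRate z.s z.r z.k) < 0 := fun y hy hty =>
      Real.log_neg (div_pos (timeRate_pos hy) hzt) ((div_lt_one hzt).2 (hty.trans_lt hlt))
    have n1 := mul_neg_of_pos_of_neg hzt (neg v hv htv)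
    have n2 := mul_neg_of_pos_of_neg hzt (neg w hw htw)
    rcases ht0.eq_or_lt with h0 | h0
    · rw [← h0] at h
      linarith
    · nlinarith [mul_nonneg (sub_nonneg.2 ht1) (neg_nonneg.2 n1.le), mul_pos h0 (neg_pos.2 n2)]
  · have hze := energyRate_pos hzv
    have h := average _ _ _ _ _ (energySlope_le hv hzv) (energySlope_le hw hzv)
    by_contra! hlt
    have neg : ∀ y : Speeds, Valid y →
        energyRate y.s y.r y.k ≤ energyRate v.s v.r v.k →
        Real.log (energyRate y.s y.r y.k / energyRate z.s z.r z.k) < 0 := fun y hy hty =>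
      Real.log_neg (div_pos (energyRate_pos hy) hze) ((div_lt_one hze).2 (hty.trans_lt hlt))
    have n1 := neg v hv le_rfl
    have n2 := neg w hw hE
    rcases ht0.eq_or_lt with h0 | h0
    · rw [← h0] at h
      linarith
    · nlinarith [mul_nonneg (sub_nonneg.2 ht1) (neg_nonneg.2 n1.le), mul_pos h0 (neg_pos.2 n2)]

/-! ### Speeds in terms of their ratios to the chase speed -/

lemma timeRate_ratio {u r : ℝ} (q : ℝ) (hu1 : u < 1) (hr : 0 < r) :
    timeRate (u * r) r (q * r) = (1 / u + 2 / (1 - u) + 2 / (q * (1 - u))) / r := by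
  have h : r - u * r = (1 - u) * r := by ring
  have h1 : 1 - u ≠ 0 := by linarith
  rw [timeRate, h, show 2 * r / (q * r * ((1 - u) * r)) = 2 / (q * (1 - u)) / r by field_simp]
  simp only [add_div, div_div]

lemma energyRate_ratio {u r : ℝ} (q : ℝ) (hu1 : u < 1) (hr : 0 < r) :
    energyRate (u * r) r (q * r) = r ^ 2 * (u ^ 2 + 1 + 2 * q ^ 2) / (1 - u) := by
  have h : r - u * r = (1 - u) * r := by ring
  have h1 : 1 - u ≠ 0 := by linarith
  rw [energyRate, h]
  field_simp

lemma energySlope_ratio {u r : ℝ} (q : ℝ) (hu1 : u < 1) (hr : 0 < r) :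
    energySlope ⟨u * r, r, q * r⟩ = ⟨2 * u ^ 2 / (u ^ 2 + 1 + 2 * q ^ 2) + u / (1 - u),
      1 + 2 / (u ^ 2 + 1 + 2 * q ^ 2) - 1 / (1 - u), 4 * q ^ 2 / (u ^ 2 + 1 + 2 * q ^ 2)⟩ := by
  have h : r - u * r = (1 - u) * r := by ring
  have h1 : 1 - u ≠ 0 := by linarith
  have he : u ^ 2 + 1 + 2 * q ^ 2 ≠ 0 := by positivity
  have hQ : (u * r) ^ 2 + r ^ 2 + 2 * (q * r) ^ 2 = (u ^ 2 + 1 + 2 * q ^ 2) * r ^ 2 := by ring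
  rw [energySlope]
  simp only [h, hQ, Speeds.mk.injEq]
  refine ⟨?_, ?_, ?_⟩ <;> field_simp

lemma timeSlope_ratio {u q r : ℝ} (hu0 : 0 < u) (hu1 : u < 1) (hq : 0 < q) (hr : 0 < r) :
    timeSlope ⟨u * r, r, q * r⟩ =
      ⟨(-(1 / u) + (2 / (1 - u) + 2 / (q * (1 - u))) * (u / (1 - u))) / r,
        (2 / (q * (1 - u)) - (2 / (1 - u) + 2 / (q * (1 - u))) * (1 / (1 - u))) / r,
        -(2 / (q * (1 - u))) / r⟩ := by
  have h : r - u * r = (1 - u) * r := by ring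
  have h1 : 1 - u ≠ 0 := by linarith
  rw [timeSlope]
  simp only [h, Speeds.mk.injEq]
  refine ⟨?_, ?_, ?_⟩ <;> field_simp

/-! ### The algebraic system for `σ`, `ρ`, `κ` -/

/-- The first two equations of the system are homogeneous and therefore only concern the ratios
`u = s / r` and `q = k / r`. They are linear in `q ^ 2` and `q ^ 3`, and solving for these powers
gives the two equations here. The third equation of the system fixes the scale `r`. -/
def RatioSystem (u q r : ℝ) : Prop :=
  (0 < u ∧ u < 1 ∧ 0 < q ∧ 0 < r) ∧
  6 * u * (1 + u) * q ^ 2 = 2 - 5 * u - 3 * u ^ 2 - 5 * u ^ 3 - u ^ 4 ∧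
  q ^ 3 * (1 + u) = u * (1 + u ^ 2) ∧
  r = 1 / u + 2 / (1 - u) + 2 / (q * (1 - u))

/-- The Lagrangian of the energy under the time constraint is stationary in the search speed, when
the multiplier is the one that makes it stationary in the return speed. -/
lemma RatioSystem.stationary_s {u q r : ℝ} (h : RatioSystem u q r) :
    2 * q ^ 3 * (1 - u) ^ 2 = u ^ 2 * (4 * q ^ 3 + 6 * q ^ 2 + 1 + 2 * u - u ^ 2) := by
  obtain ⟨⟨hu0, -⟩, hb, ha, -⟩ := h
  have : 1 + u ≠ 0 := by positivity
  refine mul_left_cancel₀ this ?_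
  linear_combination -u * hb + (2 * (1 - u) ^ 2 - 4 * u ^ 2) * ha

/-- The Lagrangian of the energy under the time constraint is stationary in the chase speed, when
the multiplier is the one that makes it stationary in the return speed. -/
lemma RatioSystem.stationary_r {u q r : ℝ} (h : RatioSystem u q r) :
    4 * q ^ 3 + 6 * u * q ^ 2 = 2 - 3 * u - u ^ 3 := by
  obtain ⟨⟨hu0, -⟩, hb, ha, -⟩ := h
  have : 1 + u ≠ 0 := by positivity
  refine mul_left_cancel₀ this ?_
  linear_combination hb + 4 * ha

/-- Every solution in terms of ratios gives a solution of the system. -/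
lemma RatioSystem.system {u q r : ℝ} (h : RatioSystem u q r) :
    SigmaRhoKappaSystem ⟨u * r, r, q * r⟩ := by
  obtain ⟨⟨hu0, hu1, hq, hr⟩, -, -, hT⟩ := id h
  have h1 : 0 < 1 - u := by linarith
  have h2 : 0 < r - u * r := by nlinarith
  have hsub : r - u * r = (1 - u) * r := by ring
  refine ⟨⟨by positivity, by linarith, by positivity⟩, ?_, ?_, ?_⟩
  · simp only [hsub]
    field_simp
    linear_combination h.stationary_s
  · linear_combination -r ^ 3 * h.stationary_r
  · simp only [hsub]
    have hr' : r * (u * q * (1 - u)) = q * (1 - u) + 2 * u * q + 2 * u := by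
      rw [hT]
      field_simp
    field_simp
    linear_combination -hr'

/-- Every solution of the system is given by a solution in terms of ratios. -/
lemma exists_ratioSystem {v : Speeds} (h : SigmaRhoKappaSystem v) :
    ∃ u q r : ℝ, RatioSystem u q r ∧ v = ⟨u * r, r, q * r⟩ := by
  obtain ⟨s, r, k⟩ := v
  obtain ⟨⟨hs, hsr, hk⟩, h1, h2, h3⟩ := h
  dsimp only at *
  have hr : 0 < r := hs.trans hsr
  obtain ⟨u, rfl⟩ : ∃ u, s = u * r := ⟨s / r, by field_simp⟩
  obtain ⟨q, rfl⟩ : ∃ q, k = q * r := ⟨k / r, by field_simp⟩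
  have hu0 : 0 < u := pos_of_mul_pos_left hs hr.le
  have hq0 : 0 < q := pos_of_mul_pos_left hk hr.le
  have hu1 : u < 1 := by
    by_contra! h
    nlinarith
  have hd : 0 < 1 - u := by linarith
  have hsub : r - u * r = (1 - u) * r := by ring
  rw [hsub] at h1 h3
  have e1 : u ^ 2 * ((1 - u) ^ 2 - 2 * q ^ 2 - 2)
      = 4 * q ^ 2 * u ^ 2 * (q + 1) - 2 * q ^ 3 * (1 - u) ^ 2 := by
    field_simp at h1
    linear_combination h1
  have e2 : 4 * q ^ 3 + 6 * u * q ^ 2 = 2 - 3 * u - u ^ 3 := by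
    have : r ^ 3 * (4 * q ^ 3 + 6 * u * q ^ 2 - (2 - 3 * u - u ^ 3)) = 0 := by
      linear_combination -h2
    rcases mul_eq_zero.1 this with h | h
    · have := pow_pos hr 3
      linarith
    · linarith
  have ha : q ^ 3 * (1 + u) = u * (1 + u ^ 2) := by
    have : (1 - u) * (q ^ 3 * (1 + u) - u * (1 + u ^ 2)) = 0 := by
      linear_combination (1 / 2) * e1 + (u / 2) * e2
    rcases mul_eq_zero.1 this with h | h
    · linarith
    · linarith
  refine ⟨u, q, r, ⟨⟨hu0, hu1, hq0, hr⟩, ?_, ha, ?_⟩, rfl⟩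
  · linear_combination (1 + u) * e2 - 4 * ha
  · field_simp at h3 ⊢
    linear_combination -h3

/-- Eliminating `q` leaves an equation between a decreasing and an increasing function of `u`. -/
lemma RatioSystem.unique {u q r u' q' r' : ℝ} (h : RatioSystem u q r)
    (h' : RatioSystem u' q' r') : u = u' ∧ q = q' ∧ r = r' := by
  have elim : ∀ {u q r : ℝ}, RatioSystem u q r →
      0 < 2 - 5 * u - 3 * u ^ 2 - 5 * u ^ 3 - u ^ 4 ∧
      (2 - 5 * u - 3 * u ^ 2 - 5 * u ^ 3 - u ^ 4) ^ 3
        = 216 * u ^ 5 * (1 + u) * (1 + u ^ 2) ^ 2 := by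
    rintro u q r ⟨⟨hu0, hu1, hq, hr⟩, hb, ha, -⟩
    rw [← hb]
    refine ⟨by positivity, ?_⟩
    linear_combination 216 * u ^ 3 * (1 + u) * (q ^ 3 * (1 + u) + u * (1 + u ^ 2)) * ha
  have key : ∀ {u q r u' q' r' : ℝ}, RatioSystem u q r → RatioSystem u' q' r' → ¬ u < u' := by
    intro u q r u' q' r' h h' hlt
    obtain ⟨hN, hE⟩ := elim h
    obtain ⟨hN', hE'⟩ := elim h'
    have hu0 := h.1.1
    have hu0' := h'.1.1
    have h1 : 2 - 5 * u' - 3 * u' ^ 2 - 5 * u' ^ 3 - u' ^ 4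
        < 2 - 5 * u - 3 * u ^ 2 - 5 * u ^ 3 - u ^ 4 := by
      have := pow_lt_pow_left₀ hlt hu0.le two_ne_zero
      have := pow_lt_pow_left₀ hlt hu0.le three_ne_zero
      have := pow_lt_pow_left₀ hlt hu0.le four_ne_zero
      linarith
    have h2 := pow_lt_pow_left₀ h1 hN'.le three_ne_zero
    have h3 : 216 * u ^ 5 * (1 + u) * (1 + u ^ 2) ^ 2
        ≤ 216 * u' ^ 5 * (1 + u') * (1 + u' ^ 2) ^ 2 := by gcongr
    linarith
  have hu : u = u' := le_antisymm (not_lt.1 (key h' h)) (not_lt.1 (key h h'))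
  subst hu
  obtain ⟨⟨hu0, hu1, hq, hr⟩, hb, ha, hT⟩ := h
  obtain ⟨⟨-, -, hq', hr'⟩, hb', ha', hT'⟩ := h'
  have hqq : q = q' := by
    have h1 : (0 : ℝ) < 6 * u * (1 + u) := by positivity
    have h2 : q ^ 2 = q' ^ 2 := mul_left_cancel₀ h1.ne' (hb.trans hb'.symm)
    exact (pow_left_inj₀ hq.le hq'.le two_ne_zero).1 h2
  subst hqq
  exact ⟨rfl, rfl, hT.trans hT'.symm⟩

/-- Existence, by the intermediate value theorem for the equation in `u`. The interval for `u` is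
so short because `σ` has to be located with an error below `1.2e-7`. -/
lemma exists_ratioSystem_bounds : ∃ u q r : ℝ, RatioSystem u q r ∧
    (0.2345176888 ≤ u ∧ u ≤ 0.2345176889) ∧ (0.5852077235 ≤ q ∧ q ≤ 0.5852077250) := by
  have hf : ContinuousOn (fun u : ℝ => (2 - 5 * u - 3 * u ^ 2 - 5 * u ^ 3 - u ^ 4) ^ 3
      - 216 * u ^ 5 * (1 + u) * (1 + u ^ 2) ^ 2) (Set.Icc 0.2345176888 0.2345176889) := by
    fun_prop
  obtain ⟨u, ⟨hu1, hu2⟩, hu⟩ := intermediate_value_Icc' (by norm_num) hf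
    (show (0 : ℝ) ∈ _ by constructor <;> norm_num)
  have hu0 : 0 < u := by linarith
  set N := 2 - 5 * u - 3 * u ^ 2 - 5 * u ^ 3 - u ^ 4 with hN
  have hN3 : N ^ 3 = 216 * u ^ 5 * (1 + u) * (1 + u ^ 2) ^ 2 := by linarith
  have hN0 : 0 < N := by
    have : 0 < N ^ 3 := by rw [hN3]; positivity
    exact (Odd.pow_pos_iff (by decide)).1 this
  have hN1 : 2 - 5 * (0.2345176889:ℝ) - 3 * 0.2345176889 ^ 2 - 5 * 0.2345176889 ^ 3
      - 0.2345176889 ^ 4 ≤ N := by rw [hN]; gcongr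
  have hN2 : N ≤ 2 - 5 * (0.2345176888:ℝ) - 3 * 0.2345176888 ^ 2 - 5 * 0.2345176888 ^ 3
      - 0.2345176888 ^ 4 := by rw [hN]; gcongr
  have hM1 : 6 * (0.2345176888:ℝ) ^ 2 * (1 + 0.2345176888 ^ 2) ≤ 6 * u ^ 2 * (1 + u ^ 2) := by
    gcongr
  have hM2 : 6 * u ^ 2 * (1 + u ^ 2) ≤ 6 * (0.2345176889:ℝ) ^ 2 * (1 + 0.2345176889 ^ 2) := by
    gcongr
  have h1u : 0 < 1 - u := by linarith
  refine ⟨u, 6 * u ^ 2 * (1 + u ^ 2) / N, _,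
    ⟨⟨hu0, by linarith, by positivity, ?_⟩, ?_, ?_, rfl⟩, ⟨hu1, hu2⟩, ?_, ?_⟩
  · positivity
  · rw [← hN]
    field_simp
    linear_combination -hN3
  · field_simp
    linear_combination -hN3
  · rw [le_div_iff₀ hN0]
    refine le_trans ?_ hM1
    refine (mul_le_mul_of_nonneg_left hN2 (by norm_num)).trans ?_
    norm_num
  · rw [div_le_iff₀ hN0]
    refine hM2.trans (le_trans ?_ (mul_le_mul_of_nonneg_left hN1 (by norm_num)))
    norm_num

/-- The triple of speeds with `u`, `q`, `r` satisfies the Karush–Kuhn–Tucker conditions without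
active speed bounds; the multiplier `2` comes from the degrees of homogeneity `2` and `-1` of
the energy and the time. -/
lemma RatioSystem.energyRate_le {u q r : ℝ} (h : RatioSystem u q r) {v : Speeds} (hv : Valid v)
    (ht : timeRate v.s v.r v.k ≤ 1) :
    energyRate (u * r) r (q * r) ≤ energyRate v.s v.r v.k := by
  obtain ⟨⟨hu0, hu1, hq, hr⟩, -, ha, hT⟩ := id h
  have h1 : 0 < 1 - u := by linarith
  have he : 0 < u ^ 2 + 1 + 2 * q ^ 2 := by positivity
  -- Stationarity in the return speed, solved for `r`.
  have hr' : r = (u ^ 2 + 1 + 2 * q ^ 2) / (q ^ 3 * (1 - u)) := by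
    rw [hT]
    field_simp
    linear_combination ha
  have e1 := h.stationary_s
  have e2 := h.stationary_r
  have hv₀ : Valid ⟨u * r, r, q * r⟩ := ⟨by positivity, by nlinarith, by positivity⟩
  refine energyRate_le_of_kkt hv hv₀ ?_ ht (l := 2) (mr := 0) (mk := 0) zero_le_two
    ?_ ?_ ?_ (by simp) (by simp)
  · simp only [timeRate_ratio q hu1 hr, ← hT]
    exact div_self hr.ne'
  · simp only [energySlope_ratio q hu1 hr, timeSlope_ratio hu0 hu1 hq hr]
    rw [hr']
    field_simp
    linear_combination -e1
  · simp only [energySlope_ratio q hu1 hr, timeSlope_ratio hu0 hu1 hq hr]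
    rw [hr']
    field_simp
    linear_combination -e2
  · simp only [energySlope_ratio q hu1 hr, timeSlope_ratio hu0 hu1 hq hr]
    rw [hr']
    field_simp
    ring

/-- Numerical bounds for `ρ`, `σ`, `κ` and for the energy. -/
lemma RatioSystem.bounds {u q r : ℝ} (h : RatioSystem u q r)
    (hu : 0.2345176888 ≤ u ∧ u ≤ 0.2345176889) (hq : 0.5852077235 ≤ q ∧ q ≤ 0.5852077250) :
    (11.34142540 ≤ r ∧ r ≤ 11.34142550) ∧ (2.65976485 ≤ u * r ∧ u * r ≤ 2.65976495) ∧
      (6.63708970 ≤ q * r ∧ q * r ≤ 6.63708990) := by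
  obtain ⟨⟨hu0, hu1, hq0, hr0⟩, -, -, hT⟩ := h
  have h1 : 0 < 1 - u := by linarith
  have hr1 : 11.34142540 ≤ r := by
    have a1 : 1 / 0.2345176889 ≤ 1 / u := one_div_le_one_div_of_le hu0 hu.2
    have a2 : 2 / (1 - 0.2345176888) ≤ 2 / (1 - u) := by gcongr; exact hu.1
    have a3 : 2 / (0.5852077250 * (1 - 0.2345176888)) ≤ 2 / (q * (1 - u)) := by
      gcongr
      · exact hq.2
      · exact hu.1
    rw [hT]
    exact le_trans (by norm_num) (add_le_add (add_le_add a1 a2) a3)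
  have hr2 : r ≤ 11.34142550 := by
    have a1 : 1 / u ≤ 1 / 0.2345176888 := one_div_le_one_div_of_le (by norm_num) hu.1
    have a2 : 2 / (1 - u) ≤ 2 / (1 - 0.2345176889) := by
      gcongr
      exact hu.2
    have a3 : 2 / (q * (1 - u)) ≤ 2 / (0.5852077235 * (1 - 0.2345176889)) := by
      gcongr
      · exact hq.1
      · exact hu.2
    rw [hT]
    exact (add_le_add (add_le_add a1 a2) a3).trans (by norm_num)
  refine ⟨⟨hr1, hr2⟩, ⟨?_, ?_⟩, ⟨?_, ?_⟩⟩
  · exact le_trans (by norm_num) (mul_le_mul hu.1 hr1 (by norm_num) hu0.le)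
  · exact (mul_le_mul hu.2 hr2 hr0.le (by norm_num)).trans (by norm_num)
  · exact le_trans (by norm_num) (mul_le_mul hq.1 hr1 (by norm_num) hq0.le)
  · exact (mul_le_mul hq.2 hr2 hr0.le (by norm_num)).trans (by norm_num)

lemma energyRate_bounds {s r k : ℝ} (hr : 11.34142540 ≤ r ∧ r ≤ 11.34142550)
    (hs : 2.65976485 ≤ s ∧ s ≤ 2.65976495) (hk : 6.63708970 ≤ k ∧ k ≤ 6.63708990) :
    292.37015 ≤ energyRate s r k ∧ energyRate s r k ≤ 292.37021 := by
  obtain ⟨hr1, hr2⟩ := hr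
  obtain ⟨hs1, hs2⟩ := hs
  obtain ⟨hk1, hk2⟩ := hk
  have hd : 0 < r - s := by linarith
  have h0 : 0 < r := by linarith
  have h1 : 11.34142540 * (2.65976485 ^ 2 + 11.34142540 ^ 2 + 2 * 6.63708970 ^ 2)
      ≤ r * (s ^ 2 + r ^ 2 + 2 * k ^ 2) := by gcongr
  have h2 : r * (s ^ 2 + r ^ 2 + 2 * k ^ 2)
      ≤ 11.34142550 * (2.65976495 ^ 2 + 11.34142550 ^ 2 + 2 * 6.63708990 ^ 2) := by
    have : 0 < s := by linarith
    have : 0 < k := by linarith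
    gcongr
  rw [energyRate, le_div_iff₀ hd, div_le_iff₀ hd]
  constructor
  · refine le_trans ?_ h1
    norm_num at hr2 hs1 ⊢
    linarith
  · refine h2.trans ?_
    norm_num at hr1 hs2 ⊢
    linarith

/-! ### The threshold `γ₁` -/

/-- The triple-angle formula turns the trigonometric expression into the root of a cubic. -/
lemma gamma1_cubic : 6 * (gamma1 - 3) ^ 3 - 171 * (gamma1 - 3) - 302 = 0 := by
  set t : ℝ := 127 / (151 * Real.sqrt 2) with ht
  have h38 : Real.sqrt 38 ^ 2 = 38 := Real.sq_sqrt (by norm_num)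
  have h3 := Real.cos_three_mul (Real.arctan t / 3)
  rw [mul_div_cancel₀ _ (three_ne_zero' ℝ), Real.cos_arctan] at h3
  have ht2 : 1 + t ^ 2 = 61731 / 45602 := by
    rw [ht, div_pow, mul_pow, Real.sq_sqrt zero_le_two]
    norm_num
  have hc : Real.sqrt 38 * (1 / Real.sqrt (1 + t ^ 2)) = 302 / 57 := by
    have h1 : 0 < Real.sqrt (1 + t ^ 2) := Real.sqrt_pos.2 (by positivity)
    rw [← pow_left_inj₀ (by positivity) (by norm_num) two_ne_zero, mul_pow, h38, div_pow,
      Real.sq_sqrt (by positivity), ht2]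
    norm_num
  have hg : gamma1 - 3 = Real.sqrt 38 * Real.cos (Real.arctan t / 3) := by
    rw [gamma1]
    ring
  rw [hg]
  linear_combination (6 * Real.cos (Real.arctan t / 3) ^ 3 * Real.sqrt 38) * h38
    - 57 * Real.sqrt 38 * h3 + 57 * hc

lemma five_lt_gamma1_sub : 5 < gamma1 - 3 := by
  set t : ℝ := 127 / (151 * Real.sqrt 2) with ht
  have ht0 : 0 < t := by positivity
  have h1 : 0 < Real.arctan t := Real.arctan_pos.2 ht0
  have h2 : Real.arctan t < Real.pi / 2 := Real.arctan_lt_pi_div_two t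
  have h3 : Real.cos (Real.pi / 6) < Real.cos (Real.arctan t / 3) :=
    Real.cos_lt_cos_of_nonneg_of_le_pi (by linarith) (by linarith [Real.pi_pos]) (by linarith)
  rw [Real.cos_pi_div_six] at h3
  have h38 : 6 < Real.sqrt 38 := by
    rw [Real.lt_sqrt (by norm_num)]
    norm_num
  have h4 : 1.7 < Real.sqrt 3 := by
    rw [Real.lt_sqrt (by norm_num)]
    norm_num
  rw [gamma1, ← ht]
  nlinarith

/-- On the relevant range, comparison with `γ₁` is decided by the sign of the cubic. -/
lemma le_gamma1_iff {x : ℝ} (hx : 6 ≤ x) :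
    x ≤ gamma1 ↔ 6 * (x - 3) ^ 3 - 171 * (x - 3) - 302 ≤ 0 := by
  have h5 := five_lt_gamma1_sub
  have hg := gamma1_cubic
  have hf : 0 < 6 * ((x - 3) ^ 2 + (x - 3) * (gamma1 - 3) + (gamma1 - 3) ^ 2) - 171 := by
    nlinarith
  have e : 6 * (x - 3) ^ 3 - 171 * (x - 3) - 302
      = (x - gamma1)
        * (6 * ((x - 3) ^ 2 + (x - 3) * (gamma1 - 3) + (gamma1 - 3) ^ 2) - 171) := by
    linear_combination hg
  rw [e, ← sub_nonpos]
  exact ⟨fun h => mul_nonpos_of_nonpos_of_nonneg h hf.le, fun h => nonpos_of_mul_nonpos_left h hf⟩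

/-- The lower bound is as sharp as `two_mul_midSigma_le` requires. -/
lemma gamma1_bounds : 9.066092 < gamma1 ∧ gamma1 < 9.066094 := by
  constructor
  · by_contra! h
    have h5 := five_lt_gamma1_sub
    have h1 : ¬ (9.0660925 : ℝ) ≤ gamma1 := by
      intro h2
      linarith
    rw [le_gamma1_iff (by norm_num)] at h1
    norm_num at h1
  · by_contra! h
    rw [le_gamma1_iff (by norm_num)] at h
    norm_num at h

/-! ### Optimal speeds when all speed bounds are active -/

/-- The smallest search speed that meets the time constraint when chase and return are carried
out at the maximal speed `x`; it is the smaller root of a quadratic polynomial. -/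
noncomputable def lowS (x : ℝ) : ℝ := (x - 3 - Real.sqrt (x ^ 2 - 10 * x + 9)) / 2

lemma lowS_spec {x : ℝ} (hx : 9 ≤ x) :
    0 < lowS x ∧ 3 * lowS x ≤ x ∧ lowS x ^ 2 + (3 - x) * lowS x + x = 0 := by
  have h0 : 0 ≤ x ^ 2 - 10 * x + 9 := by nlinarith
  have hsq := Real.sq_sqrt h0
  have hn := Real.sqrt_nonneg (x ^ 2 - 10 * x + 9)
  rw [lowS]
  set D := Real.sqrt (x ^ 2 - 10 * x + 9)
  have hD : D < x - 3 := by
    by_contra! h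
    nlinarith
  refine ⟨by linarith, ?_, ?_⟩
  · by_contra! h
    nlinarith
  · linear_combination hsq / 4

/-- The ratio `u = lowS x / x` is at most `1 / 3`, and `x` is a rational function of it. -/
lemma lowS_ratio {x : ℝ} (hx : 9 ≤ x) : ∃ u : ℝ, 0 < u ∧ 3 * u ≤ 1 ∧ lowS x = u * x ∧
    x * (u * (1 - u)) = 1 + 3 * u := by
  obtain ⟨h1, h2, h3⟩ := lowS_spec hx
  have hx0 : 0 < x := by linarith
  have hu : lowS x = lowS x / x * x := by field_simp
  refine ⟨lowS x / x, by positivity, ?_, hu, ?_⟩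
  · rw [← mul_div_assoc, div_le_one hx0]
    exact h2
  · field_simp
    linear_combination -h3

lemma timeRate_lowS {x : ℝ} (hx : 9 ≤ x) : timeRate (lowS x) x x = 1 := by
  obtain ⟨u, hu0, hu3, hus, hux⟩ := lowS_ratio hx
  have h1 : 0 < 1 - u := by linarith
  have h := timeRate_ratio (u := u) 1 (by linarith) (show 0 < x by linarith)
  rw [one_mul] at h
  rw [hus, h]
  field_simp
  linear_combination -hux

/-- The announced competitive ratio; its square root is `x - 3 - 2 * lowS x`. -/
lemma energyRate_lowS {x : ℝ} (hx : 9 ≤ x) : energyRate (lowS x) x x = lowRatio x := by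
  obtain ⟨h1, h2, h3⟩ := lowS_spec hx
  have hd : x - lowS x ≠ 0 := by linarith
  have hD : Real.sqrt ((x - 9) * (x - 1)) = x - 3 - 2 * lowS x := by
    rw [lowS, show (x - 9) * (x - 1) = x ^ 2 - 10 * x + 9 by ring]
    ring
  rw [energyRate, lowRatio, hD, div_eq_iff hd]
  linear_combination x ^ 2 * h3

/-- For `x = 9` the time constraint and the speed bounds admit only one triple of speeds. Here the
Karush–Kuhn–Tucker conditions fail, since `lowS 9` is a double root and the multiplier of the time
constraint would be infinite. -/
lemma eq_of_timeRate_le_nine {v : Speeds} (hv : Valid v) (ht : timeRate v.s v.r v.k ≤ 1)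
    (hr : v.r ≤ 9) (hk : v.k ≤ 9) : v.s = 3 ∧ v.r = 9 ∧ v.k = 9 := by
  obtain ⟨s, r, k⟩ := v
  obtain ⟨hs, hsr, hk0⟩ := hv
  dsimp only at *
  have hd : 0 < r - s := by linarith
  have h0 : 0 < r := by linarith
  have ht' : k * (r - s) + 2 * k * s + 2 * r * s ≤ s * k * (r - s) := by
    rw [timeRate] at ht
    have : 1 / s + 2 / (r - s) + 2 * r / (k * (r - s))
        = (k * (r - s) + 2 * k * s + 2 * r * s) / (s * k * (r - s)) := by
      field_simp
    rwa [this, div_le_one (by positivity)] at ht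
  -- Increasing the return speed and then the chase speed to `9` relaxes the constraint.
  have h1 : 9 * (r - s) + 18 * s + 2 * r * s + 2 * r * s * (9 - k) / k ≤ 9 * s * (r - s) := by
    have e : 9 * (r - s) + 18 * s + 2 * r * s + 2 * r * s * (9 - k) / k
        = 9 / k * (k * (r - s) + 2 * k * s + 2 * r * s) := by
      field_simp
      ring
    rw [e, show 9 * s * (r - s) = 9 / k * (s * k * (r - s)) by field_simp]
    exact mul_le_mul_of_nonneg_left ht' (by positivity)
  have h2 : 0 ≤ 2 * r * s * (9 - k) / k := by
    have : 0 ≤ 9 - k := by linarith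
    positivity
  have h3 : 9 * (r - s) + 18 * s + 2 * r * s - 9 * s * (r - s)
      = 9 * (s - 3) ^ 2 + (9 - r) * (7 * s - 9) := by ring
  have h4 : 9 < 7 * s := by
    by_contra! h
    nlinarith
  have hr9 : r = 9 := by
    by_contra! h
    have : 0 < 9 - r := by
      rcases lt_or_eq_of_le hr with h' | h'
      · linarith
      · exact absurd h' h
    nlinarith [sq_nonneg (s - 3)]
  subst hr9
  have hs3 : s = 3 := by
    have : (s - 3) ^ 2 = 0 := le_antisymm (by linarith) (sq_nonneg _)
    linarith [pow_eq_zero_iff two_ne_zero |>.1 this]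
  subst hs3
  refine ⟨rfl, rfl, le_antisymm hk ?_⟩
  linarith

/-- Up to `γ₁` both speed bounds have nonnegative multipliers. -/
lemma energyRate_lowS_le {x : ℝ} (hx : 9 ≤ x) (hxg : x ≤ gamma1) {v : Speeds} (hv : Valid v)
    (ht : timeRate v.s v.r v.k ≤ 1) (hr : v.r ≤ x) (hk : v.k ≤ x) :
    energyRate (lowS x) x x ≤ energyRate v.s v.r v.k := by
  have hx0 : 0 < x := by linarith
  have htime := timeRate_lowS hx
  obtain ⟨u, hu0, hu3, hus, hux⟩ := lowS_ratio hx
  have h1 : 0 < 1 - u := by linarith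
  rcases hu3.eq_or_lt with h3 | h3
  · have hu : u = 1 / 3 := by linarith
    have hx9 : x = 9 := by
      rw [hu] at hux
      linarith
    subst hx9
    obtain ⟨e1, e2, e3⟩ := eq_of_timeRate_le_nine hv ht hr hk
    rw [e1, e2, e3, hus, hu]
    norm_num
  · have h3' : 0 < 1 - 3 * u := by linarith
    -- The condition `x ≤ γ₁`, expressed through `u`, is the sign condition for the multiplier `mk`.
    have hcub : u ^ 3 - 3 * u ^ 2 - 6 * u + 2 ≤ 0 := by
      rw [le_gamma1_iff (by linarith)] at hxg
      by_contra! hneg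
      have hq : 0 < 3 + 9 * u - 27 * u ^ 2 - 49 * u ^ 3 := by nlinarith [mul_pos hu0 h3']
      have hp : 0 < (u * (1 - u)) ^ 3 := by positivity
      have hy : (x - 3) * (u * (1 - u)) = 1 + 3 * u ^ 2 := by linear_combination hux
      have e : (6 * (x - 3) ^ 3 - 171 * (x - 3) - 302) * (u * (1 - u)) ^ 3
          = (u ^ 3 - 3 * u ^ 2 - 6 * u + 2) * (3 + 9 * u - 27 * u ^ 2 - 49 * u ^ 3) := by
        have e3 : ((x - 3) * (u * (1 - u))) ^ 3 = (1 + 3 * u ^ 2) ^ 3 := by rw [hy]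
        linear_combination 6 * e3 - 171 * (u * (1 - u)) ^ 2 * hy
      have := mul_pos hneg hq
      rw [← e] at this
      exact absurd (pos_of_mul_pos_left this hp.le) (not_lt.2 hxg)
    have hu29 : 0.29 < u := by
      by_contra! h
      nlinarith [mul_nonneg hu0.le (sub_nonneg.2 h), sq_nonneg u]
    have he : 0 < u ^ 2 + 3 := by positivity
    set l := u ^ 2 * (3 - u) * (1 - u) / ((u ^ 2 + 3) * (1 - 3 * u)) * x with hl
    have hv₀ : Valid ⟨u * x, x, 1 * x⟩ := ⟨by positivity, by nlinarith, by positivity⟩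
    have hul : 0 < 3 - u := by linarith
    have h3n : 1 - u * 3 ≠ 0 := by linarith
    have key := energyRate_le_of_kkt hv hv₀ (by simpa [hus] using htime) ht
      (l := l)
      (mr := (2 * u ^ 2 * (3 - u) * (1 + u) - (1 - 3 * u) * (2 - 5 * u - u ^ 3))
        / ((1 - u) * (u ^ 2 + 3) * (1 - 3 * u)))
      (mk := 2 * -(u ^ 3 - 3 * u ^ 2 - 6 * u + 2) / ((u ^ 2 + 3) * (1 - 3 * u)))
      (by positivity) ?_ ?_ ?_ ?_ ?_
    · simpa [hus] using key
    · simp only [energySlope_ratio 1 (show u < 1 by linarith) hx0,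
        timeSlope_ratio hu0 (show u < 1 by linarith) one_pos hx0, hl]
      rw [show u ^ 2 + 1 + 2 * 1 ^ 2 = u ^ 2 + 3 by ring]
      field_simp
      ring
    · simp only [energySlope_ratio 1 (show u < 1 by linarith) hx0,
        timeSlope_ratio hu0 (show u < 1 by linarith) one_pos hx0, hl]
      rw [show u ^ 2 + 1 + 2 * 1 ^ 2 = u ^ 2 + 3 by ring]
      field_simp
      ring
    · simp only [energySlope_ratio 1 (show u < 1 by linarith) hx0,
        timeSlope_ratio hu0 (show u < 1 by linarith) one_pos hx0, hl]
      rw [show u ^ 2 + 1 + 2 * 1 ^ 2 = u ^ 2 + 3 by ring]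
      field_simp
      ring
    · refine mul_nonpos_of_nonneg_of_nonpos (div_nonneg ?_ (by positivity))
        (Real.log_nonpos (div_pos hv.r_pos hx0).le ((div_le_one hx0).2 hr))
      have e : 2 * u ^ 2 * (3 - u) * (1 + u) - (1 - 3 * u) * (2 - 5 * u - u ^ 3)
          = -2 + 11 * u - 9 * u ^ 2 + 5 * u ^ 3 - 5 * u ^ 4 := by ring
      rw [e]
      nlinarith [mul_pos (sub_pos.2 hu29) h3', pow_pos hu0 3, mul_pos (pow_pos hu0 3) h1]
    · refine mul_nonpos_of_nonneg_of_nonpos (div_nonneg (by linarith) (by positivity))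
        (Real.log_nonpos (div_nonneg hv.2.2.le (by positivity)) ?_)
      simpa using (div_le_one hx0).2 hk

/-! ### Nearly optimal speeds when only the bound on the chase speed is active -/

/-- The denominator of the ratio of the return speed to `b` in the middle regime. -/
noncomputable def midDen (x : ℝ) : ℝ :=
  x * midSigma x - 1 - x * midSigma x ^ 2 - midSigma x

/-- Data for a lower bound of the energy at chase speed `x`. The numbers `a`, `v`, `n` approximate
the optimal return ratio `q`, the optimal search ratio `u` and its inverse `1 / u`; they are the
points at which `q ^ 2`, `u ^ 2` and `1 / u` are replaced by tangents. The lower bound that results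
is `x ^ 2 * M`, up to a slope in `u`, which is bounded by `0.005` and absorbed by the square that
the tangent of `u ^ 2` leaves. The first inequality says that the chosen speeds have energy at most
`x ^ 2 * M + 0.03`. -/
def MidCertificate (x : ℝ) : Prop :=
  ∃ a v n M : ℝ, 0 ≤ a ∧
    0 ≤ M * ((1 - midSigma x) * midDen x ^ 2 * x ^ 2)
      - ((midSigma x ^ 2 + 1) * midDen x ^ 2 + 8 * midSigma x ^ 2) * x ^ 2
      + 0.03 * (1 - midSigma x) * midDen x ^ 2 ∧
    |2 * v + 2 * a ^ 3 * x - 2 * a ^ 3 * n ^ 2 + M| ≤ 0.005 ∧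
    0.005 ^ 2 / 4 ≤ 1 + 6 * a ^ 2 - v ^ 2 - 2 * a ^ 3 * (x - 1) + 4 * a ^ 3 * n - M
      + (2 * v + 2 * a ^ 3 * x - 2 * a ^ 3 * n ^ 2 + M) * v

lemma midCertificate_first {t : ℝ} (h0 : 0 ≤ t) (h1 : t ≤ 1) :
    MidCertificate (9.06 + 0.6 * t) := by
  -- The four witnesses interpolate the optimal data on this interval. Each polynomial inequality is
  -- proved by expansion in the Bernstein basis `t ^ i * s ^ (m - i)`, `s = 1 - t`, in which all
  -- coefficients are positive.
  refine ⟨1.0018 - 0.1874 * t + 0.028 * t ^ 2, 0.2944 - 0.0173 * t,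
    3.396 + 0.205 * t + 0.0063 * t ^ 2,
    4.3855522 - 1.2069029 * t + 0.3443474 * t ^ 2 - 0.0868614 * t ^ 3 + 0.0187527 * t ^ 4
      - 0.0025641 * t ^ 5,
    by nlinarith, ?_, abs_le.2 ⟨?_, ?_⟩, ?_⟩
  · have h : ∀ s : ℝ, 0 ≤ s → 0 ≤
        0.00005919764226488063556551092618926132179242215087928469720064 * s ^ 14
          + 0.00125798933029195278473793144192202292137201527929783544016896 * t * s ^ 13
          + 0.00635633348505207738265957778324231593196547416401413625396224 * t ^ 2 * s ^ 12
          + 0.01874517171834350943220843898367825166061866706691976312221696 * t ^ 3 * s ^ 11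
          + 0.05283923286753060896600368251719659593393899005744087337739264 * t ^ 4 * s ^ 10
          + 0.14093866327138976575100051304140745711543892668642406458390528 * t ^ 5 * s ^ 9
          + 0.27437366309912431802761575683585978338415064696497132804385792 * t ^ 6 * s ^ 8
          + 0.35231054357072140778548671349502797329848803574305658732494848 * t ^ 7 * s ^ 7
          + 0.29420507873400260994296436194868651590235390084005568257774592 * t ^ 8 * s ^ 6
          + 0.16229545487133900024767973261869318150582943238406047244156928 * t ^ 9 * s ^ 5
          + 0.06487443729947499091086746302770833342239981846544272200766464 * t ^ 10 * s ^ 4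
          + 0.02376411488359851778926290841409239457386863931992886009040896 * t ^ 11 * s ^ 3
          + 0.00821194997182570357254669956868604245556601801207198145690624 * t ^ 12 * s ^ 2
          + 0.00169638013711101070506224505186457195152107074350663526864896 * t ^ 13 * s
          + 0.00008842468319692175925465199180099126354796408038220985713664 * t ^ 14 :=
      fun s hs => by positivity
    simp only [midDen, midSigma]
    linear_combination h (1 - t) (sub_nonneg.2 h1)
  · have h : ∀ s : ℝ, 0 ≤ s → 0 ≤
        0.006965686814034176 * s ^ 10 + 0.025313949944460416 * t * s ^ 9
          + 0.0433887335272072416 * t ^ 2 * s ^ 8 + 0.1630200969531899904 * t ^ 3 * s ^ 7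
          + 0.61338627063766510704 * t ^ 4 * s ^ 6 + 1.24919744015031819088 * t ^ 5 * s ^ 5
          + 1.44032034746882948048 * t ^ 6 * s ^ 4 + 0.97062430062075829744 * t ^ 7 * s ^ 3
          + 0.36751307969558045504 * t ^ 8 * s ^ 2 + 0.06656550024800746752 * t ^ 9 * s
          + 0.00314716803086814208 * t ^ 10 :=
      fun s hs => by positivity
    linear_combination h (1 - t) (sub_nonneg.2 h1)
  · have h : ∀ s : ℝ, 0 ≤ s → 0 ≤
        0.003034313185965824 * s ^ 10 + 0.074686050055539584 * t * s ^ 9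
          + 0.4066112664727927584 * t ^ 2 * s ^ 8 + 1.0369799030468100096 * t ^ 3 * s ^ 7
          + 1.48661372936233489296 * t ^ 4 * s ^ 6 + 1.27080255984968180912 * t ^ 5 * s ^ 5
          + 0.65967965253117051952 * t ^ 6 * s ^ 4 + 0.22937569937924170256 * t ^ 7 * s ^ 3
          + 0.08248692030441954496 * t ^ 8 * s ^ 2 + 0.03343449975199253248 * t ^ 9 * s
          + 0.00685283196913185792 * t ^ 10 :=
      fun s hs => by positivity
    linear_combination h (1 - t) (sub_nonneg.2 h1)
  · have h : ∀ s : ℝ, 0 ≤ s → 0 ≤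
        0.0002492634880996614144 * s ^ 11 + 0.00271542156919401664 * t * s ^ 10
          + 0.01315182046804219320064 * t ^ 2 * s ^ 9 + 0.03728563330260825982112 * t ^ 3 * s ^ 8
          + 0.068991998236903953852416 * t ^ 4 * s ^ 7 + 0.087957272477496276555856 * t ^ 5 * s ^ 6
          + 0.07916846959221736974616 * t ^ 6 * s ^ 5 + 0.050344029593250291807344 * t ^ 7 * s ^ 4
          + 0.0220813256237350101844 * t ^ 8 * s ^ 3 + 0.006320705883897142529472 * t ^ 9 * s ^ 2
          + 0.001061852890076050278144 * t ^ 10 * s + 0.000081667502774362170368 * t ^ 11 :=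
      fun s hs => by positivity
    linear_combination h (1 - t) (sub_nonneg.2 h1)

lemma midCertificate_second {t : ℝ} (h0 : 0 ≤ t) (h1 : t ≤ 1) :
    MidCertificate (9.66 + 0.6 * t) := by
  refine ⟨0.8421 - 0.1323 * t + 0.0174 * t ^ 2, 0.2771 - 0.0162 * t,
    3.6074 + 0.218 * t + 0.0059 * t ^ 2,
    3.4523239 - 0.7165799 * t + 0.1707629 * t ^ 2 - 0.0364158 * t ^ 3 + 0.0067941 * t ^ 4
      - 0.0008357 * t ^ 5,
    by nlinarith, ?_, abs_le.2 ⟨?_, ?_⟩, ?_⟩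
  · have h : ∀ s : ℝ, 0 ≤ s → 0 ≤
        0.00008842468319692175925465199180099126354796408038220985713664 * s ^ 14
          + 0.00143369768385386252776606059739244266531170297697181138743296 * t * s ^ 13
          + 0.00871408969382058196599794376661033282933434808581443117005824 * t ^ 2 * s ^ 12
          + 0.03274376749637608869345675345569850219225232329473704261533696 * t ^ 3 * s ^ 11
          + 0.09227382158722131956502313166845710744336217825909745466276864 * t ^ 4 * s ^ 10
          + 0.20210686865105609202277571165993337234430487381760233823664128 * t ^ 5 * s ^ 9
          + 0.33329971824853029471866946598808372493895562224787246347656192 * t ^ 6 * s ^ 8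
          + 0.40194743597134743541585711769932501066653686928881676440936448 * t ^ 7 * s ^ 7
          + 0.35119812959358969851390032898970457661877086240615187165576192 * t ^ 8 * s ^ 6
          + 0.22441726652305008101543829534146465001444839136516958486806528 * t ^ 9 * s ^ 5
          + 0.10780715484984824202248702323499903178679110222036023681086464 * t ^ 10 * s ^ 4
          + 0.04005126253962002967726023073824061650147265873308650876624896 * t ^ 11 * s ^ 3
          + 0.01109998909887781024860231550693129761063645374994882906522624 * t ^ 12 * s ^ 2
          + 0.00190685664980326478857209007782001030715477937814453934954496 * t ^ 13 * s
          + 0.00012582775991669474186952230752684940029952136982909293425664 * t ^ 14 :=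
      fun s hs => by positivity
    simp only [midDen, midSigma]
    linear_combination h (1 - t) (sub_nonneg.2 h1)
  · have h : ∀ s : ℝ, 0 ≤ s → 0 ≤
        0.00656643026387831128 * s ^ 10 + 0.04244093962651630808 * t * s ^ 9
          + 0.1524389600724927872 * t ^ 2 * s ^ 8 + 0.42631607846981097376 * t ^ 3 * s ^ 7
          + 0.91145200267624380014 * t ^ 4 * s ^ 6 + 1.35865717048545199358 * t ^ 5 * s ^ 5
          + 1.34041151603436429298 * t ^ 6 * s ^ 4 + 0.84256987070113808834 * t ^ 7 * s ^ 3
          + 0.3167629632855315432 * t ^ 8 * s ^ 2 + 0.06188350078969898368 * t ^ 9 * s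
          + 0.00423568737334578176 * t ^ 10 :=
      fun s hs => by positivity
    linear_combination h (1 - t) (sub_nonneg.2 h1)
  · have h : ∀ s : ℝ, 0 ≤ s → 0 ≤
        0.00343356973612168872 * s ^ 10 + 0.05755906037348369192 * t * s ^ 9
          + 0.2975610399275072128 * t ^ 2 * s ^ 8 + 0.77368392153018902624 * t ^ 3 * s ^ 7
          + 1.18854799732375619986 * t ^ 4 * s ^ 6 + 1.16134282951454800642 * t ^ 5 * s ^ 5
          + 0.75958848396563570702 * t ^ 6 * s ^ 4 + 0.35743012929886191166 * t ^ 7 * s ^ 3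
          + 0.1332370367144684568 * t ^ 8 * s ^ 2 + 0.03811649921030101632 * t ^ 9 * s
          + 0.00576431262665421824 * t ^ 10 :=
      fun s hs => by positivity
    linear_combination h (1 - t) (sub_nonneg.2 h1)
  · have h : ∀ s : ℝ, 0 ≤ s → 0 ≤
        0.000081530552846280055688 * s ^ 11 + 0.00072416457334872038192 * t * s ^ 10
          + 0.002843720310139856111192 * t ^ 2 * s ^ 9 + 0.006438563214605189009376 * t ^ 3 * s ^ 8
          + 0.009271457111136440072778 * t ^ 4 * s ^ 7 + 0.008908601253670754877544 * t ^ 5 * s ^ 6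
          + 0.00589658409808757070978 * t ^ 6 * s ^ 5 + 0.002791842016396608317496 * t ^ 7 * s ^ 4
          + 0.001006734502649717868626 * t ^ 8 * s ^ 3 + 0.000297510744155167998608 * t ^ 9 * s ^ 2
          + 0.000070506079250580967808 * t ^ 10 * s + 0.000009850857875514461184 * t ^ 11 :=
      fun s hs => by positivity
    linear_combination h (1 - t) (sub_nonneg.2 h1)

lemma midCertificate_third {t : ℝ} (h0 : 0 ≤ t) (h1 : t ≤ 1) :
    MidCertificate (10.26 + 0.6 * t) := by
  refine ⟨0.727 - 0.098 * t + 0.0115 * t ^ 2, 0.2609 - 0.0151 * t,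
    3.8315 + 0.2304 * t + 0.0053 * t ^ 2,
    2.8760494 - 0.4612973 * t + 0.0939552 * t ^ 2 - 0.0172787 * t ^ 3 + 0.00284 * t ^ 4 -
      0.0003172 * t ^ 5,
    by nlinarith, ?_, abs_le.2 ⟨?_, ?_⟩, ?_⟩
  · have h : ∀ s : ℝ, 0 ≤ s → 0 ≤
        0.00012174486589454855756078125805051399202008223754437343448064 * s ^ 14
          + 0.00181519433799109925137034661084449458696137513823689043562496 * t * s ^ 13
          + 0.01166532646438033208012732190696919260188876147805864317389824 * t ^ 2 * s ^ 12
          + 0.04628519445450028423091388455467264752781416601844152020535296 * t ^ 3 * s ^ 11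
          + 0.12989324073298737882391207906601068990350165149350467621233664 * t ^ 4 * s ^ 10
          + 0.27083190792119806486740794034420231863989720786662394031228928 * t ^ 5 * s ^ 9
          + 0.42435156634485500511036232148118157840871192806939436863214592 * t ^ 6 * s ^ 8
          + 0.49951247173862825642321212911684358590764007046506776753000448 * t ^ 7 * s ^ 7
          + 0.44132229578164436778465531398726942174868321978400644106171392 * t ^ 8 * s ^ 6
          + 0.29289574338180795686860375642415126871933183671234568871600128 * t ^ 9 * s ^ 5
          + 0.14598596988613540092945651330815006412971005230236836475556864 * t ^ 10 * s ^ 4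
          + 0.05397646896827442173370192047683368774780921506696157413124096 * t ^ 11 * s ^ 3
          + 0.01408800925097460731263863872237035980143566482649853647002624 * t ^ 12 * s ^ 2
          + 0.00226969384507801048533556087448634472688350317107973626628096 * t ^ 13 * s
          + 0.00015852132056648894448411934342262927338787983406971385662464 * t ^ 14 :=
      fun s hs => by positivity
    simp only [midDen, midSigma]
    linear_combination h (1 - t) (sub_nonneg.2 h1)
  · have h : ∀ s : ℝ, 0 ≤ s → 0 ≤
        0.0058612095426365 * s ^ 10 + 0.0451552076471488 * t * s ^ 9
          + 0.18043090715313389 * t ^ 2 * s ^ 8 + 0.4916161287618438 * t ^ 3 * s ^ 7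
          + 0.955840453591807255 * t ^ 4 * s ^ 6 + 1.30220020088414276 * t ^ 5 * s ^ 5
          + 1.2084848219851268775 * t ^ 6 * s ^ 4 + 0.73662139029255359 * t ^ 7 * s ^ 3
          + 0.27705666361176503 * t ^ 8 * s ^ 2 + 0.056579738666376 * t ^ 9 * s
          + 0.00449861028215264 * t ^ 10 :=
      fun s hs => by positivity
    linear_combination h (1 - t) (sub_nonneg.2 h1)
  · have h : ∀ s : ℝ, 0 ≤ s → 0 ≤
        0.0041387904573635 * s ^ 10 + 0.0548447923528512 * t * s ^ 9
          + 0.26956909284686611 * t ^ 2 * s ^ 8 + 0.7083838712381562 * t ^ 3 * s ^ 7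
          + 1.144159546408192745 * t ^ 4 * s ^ 6 + 1.21779979911585724 * t ^ 5 * s ^ 5
          + 0.8915151780148731225 * t ^ 6 * s ^ 4 + 0.46337860970744641 * t ^ 7 * s ^ 3
          + 0.17294333638823497 * t ^ 8 * s ^ 2 + 0.043420261333624 * t ^ 9 * s
          + 0.00550138971784736 * t ^ 10 :=
      fun s hs => by positivity
    linear_combination h (1 - t) (sub_nonneg.2 h1)
  · have h : ∀ s : ℝ, 0 ≤ s → 0 ≤
        0.00000980746767386285 * s ^ 11 + 0.00014363559552117362 * t * s ^ 10
          + 0.000988978118921806941 * t ^ 2 * s ^ 9 + 0.004025510815205357582 * t ^ 3 * s ^ 8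
          + 0.0106331155090637188695 * t ^ 4 * s ^ 7 + 0.019106029102839069363 * t ^ 5 * s ^ 6
          + 0.02384666421949189274775 * t ^ 6 * s ^ 5 + 0.0206996163191214181205 * t ^ 7 * s ^ 4
          + 0.012265827884169168749 * t ^ 8 * s ^ 3 + 0.004736136052879342774 * t ^ 9 * s ^ 2
          + 0.001076056004908844576 * t ^ 10 * s + 0.000109521319953118912 * t ^ 11 :=
      fun s hs => by positivity
    linear_combination h (1 - t) (sub_nonneg.2 h1)

lemma midCertificate_fourth {t : ℝ} (h0 : 0 ≤ t) (h1 : t ≤ 1) :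
    MidCertificate (10.86 + 0.6 * t) := by
  refine ⟨0.6405 - 0.0753 * t + 0.0079 * t ^ 2, 0.2458 - 0.014 * t,
    4.067 + 0.2416 * t + 0.005 * t ^ 2,
    2.4939514 - 0.3154467 * t + 0.0559973 * t ^ 2 - 0.0089799 * t ^ 3 + 0.0013237 * t ^ 4
      - 0.0001348 * t ^ 5,
    by nlinarith, ?_, abs_le.2 ⟨?_, ?_⟩, ?_⟩
  · have h : ∀ s : ℝ, 0 ≤ s → 0 ≤
        0.00015852132056648894448411934342262927338787983406971385662464 * s ^ 14
          + 0.00229111450150435947560807641835607432886451343407717131677696 * t * s ^ 13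
          + 0.01493743016049802332683539503383125571522129205070058770842624 * t ^ 2 * s ^ 12
          + 0.06000548691085284850213661769813417019154683557298216239261696 * t ^ 3 * s ^ 11
          + 0.16747000624679703022534354250180280482200519707818347789323264 * t ^ 4 * s ^ 10
          + 0.34257865924629730671232135132511391335379840273007756704688128 * t ^ 5 * s ^ 9
          + 0.52586999872991423143773758125326875522146532803509606019310592 * t ^ 6 * s ^ 8
          + 0.61152444912675685860574746448805524623786042421929461607272448 * t ^ 7 * s ^ 7
          + 0.54008695307428504722977115919199992119244442687521991669793792 * t ^ 8 * s ^ 6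
          + 0.36136518512157304387051067302646469306484513194242725573705728 * t ^ 9 * s ^ 5
          + 0.18143698046150683553554337617994299860038688917615485367921664 * t ^ 10 * s ^ 4
          + 0.06676501869353907500046151463086167175046281065512003110864896 * t ^ 11 * s ^ 3
          + 0.01706852766606166639897011059373466783016686522480260335821824 * t ^ 12 * s ^ 2
          + 0.00269030501069398047195166755258639896188543816777542721284096 * t ^ 13 * s
          + 0.00019180095157116596508811203306782927581446621891901750078464 * t ^ 14 :=
      fun s hs => by positivity
    simp only [midDen, midSigma]
    linear_combination h (1 - t) (sub_nonneg.2 h1)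
  · have h : ∀ s : ℝ, 0 ≤ s → 0 ≤
        0.00535354359523775 * s ^ 10 + 0.04552435269022045 * t * s ^ 9
          + 0.19155174494488976 * t ^ 2 * s ^ 8 + 0.51859888414079317 * t ^ 3 * s ^ 7
          + 0.9687376048472773584 * t ^ 4 * s ^ 6 + 1.26154477610559031944 * t ^ 5 * s ^ 5
          + 1.13081748888969313864 * t ^ 6 * s ^ 4 + 0.67689102221182469824 * t ^ 7 * s ^ 3
          + 0.2552467229527847056 * t ^ 8 * s ^ 2 + 0.05383011402109626624 * t ^ 9 * s
          + 0.00468204391499024128 * t ^ 10 :=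
      fun s hs => by positivity
    linear_combination h (1 - t) (sub_nonneg.2 h1)
  · have h : ∀ s : ℝ, 0 ≤ s → 0 ≤
        0.00464645640476225 * s ^ 10 + 0.05447564730977955 * t * s ^ 9
          + 0.25844825505511024 * t ^ 2 * s ^ 8 + 0.68140111585920683 * t ^ 3 * s ^ 7
          + 1.1312623951527226416 * t ^ 4 * s ^ 6 + 1.25845522389440968056 * t ^ 5 * s ^ 5
          + 0.96918251111030686136 * t ^ 6 * s ^ 4 + 0.52310897778817530176 * t ^ 7 * s ^ 3
          + 0.1947532770472152944 * t ^ 8 * s ^ 2 + 0.04616988597890373376 * t ^ 9 * s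
          + 0.00531795608500975872 * t ^ 10 :=
      fun s hs => by positivity
    linear_combination h (1 - t) (sub_nonneg.2 h1)
  · have h : ∀ s : ℝ, 0 ≤ s → 0 ≤
        0.00010945682420943895 * s ^ 11 + 0.00133091337663229706 * t * s ^ 10
          + 0.007268900785487003318 * t ^ 2 * s ^ 9 + 0.023540125448020407554 * t ^ 3 * s ^ 8
          + 0.05023054211554783150072 * t ^ 4 * s ^ 7 + 0.074138608652002592195472 * t ^ 5 * s ^ 6
          + 0.077185433154883209523904 * t ^ 6 * s ^ 5 + 0.056618435873938980364144 * t ^ 7 * s ^ 4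
          + 0.028631193780701845688512 * t ^ 8 * s ^ 3 + 0.009485491589025756999872 * t ^ 9 * s ^ 2
          + 0.001847841892690715821056 * t ^ 10 * s + 0.000159793614245137928704 * t ^ 11 :=
      fun s hs => by positivity
    linear_combination h (1 - t) (sub_nonneg.2 h1)

lemma midSigma_bounds {x : ℝ} (h1 : 9.06 ≤ x) (h2 : x ≤ 11.46) :
    0.2314 < midSigma x ∧ midSigma x < 0.2945 := by
  rw [midSigma]
  constructor <;> linarith

lemma midDen_pos {x : ℝ} (h1 : 9.06 ≤ x) (h2 : x ≤ 11.46) : 0 < midDen x := by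
  obtain ⟨y, rfl⟩ : ∃ y, x = 9.06 + y := ⟨x - 9.06, by ring⟩
  have hy0 : 0 ≤ y := by linarith
  have hy1 : 0 ≤ 2.4 - y := by linarith
  simp only [midDen, midSigma]
  nlinarith [mul_nonneg hy0 hy1, mul_nonneg (mul_nonneg hy0 hy0) hy1]

/-- The return speed stays below the bound; at `x = γ₁` there is almost equality. -/
lemma two_mul_midSigma_le {x : ℝ} (h1 : 9.066092 ≤ x) (h2 : x ≤ 11.46) :
    2 * midSigma x ≤ midDen x := by
  obtain ⟨y, rfl⟩ : ∃ y, x = 9.066092 + y := ⟨x - 9.066092, by ring⟩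
  have hy0 : 0 ≤ y := by linarith
  have hy1 : 0 ≤ 2.4 - y := by linarith
  simp only [midDen, midSigma]
  nlinarith [mul_nonneg hy0 hy1, mul_nonneg (mul_nonneg hy0 hy0) hy1]

lemma midKappa_eq (x : ℝ) : midKappa x = 2 * midSigma x / midDen x := rfl

lemma midCertificate {x : ℝ} (h1 : 9.06 ≤ x) (h2 : x ≤ 11.46) : MidCertificate x := by
  have key : ∀ lo : ℝ, lo ≤ x → x ≤ lo + 0.6 → ∃ t : ℝ, 0 ≤ t ∧ t ≤ 1 ∧ x = lo + 0.6 * t :=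
    fun lo ha hb => ⟨(x - lo) / 0.6, div_nonneg (sub_nonneg.2 ha) (by norm_num),
      (div_le_one (by norm_num)).2 (by linarith), by ring⟩
  rcases le_total x 9.66 with h | h
  · obtain ⟨t, t0, t1, rfl⟩ := key 9.06 h1 (by linarith)
    exact midCertificate_first t0 t1
  rcases le_total x 10.26 with h' | h'
  · obtain ⟨t, t0, t1, rfl⟩ := key 9.66 h (by linarith)
    exact midCertificate_second t0 t1
  rcases le_total x 10.86 with h'' | h''
  · obtain ⟨t, t0, t1, rfl⟩ := key 10.26 h' (by linarith)
    exact midCertificate_third t0 t1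
  · obtain ⟨t, t0, t1, rfl⟩ := key 10.86 h'' (by linarith)
    exact midCertificate_fourth t0 t1

lemma timeRate_mid {x : ℝ} (h1 : 9.06 ≤ x) (h2 : x ≤ 11.46) :
    timeRate (midSigma x * x) x (midKappa x * x) = 1 := by
  obtain ⟨hu0, hu1⟩ := midSigma_bounds h1 h2
  have hD := midDen_pos h1 h2
  have hx : 0 < x := by linarith
  have hu : 0 < midSigma x := by linarith
  have h1u : 0 < 1 - midSigma x := by linarith
  rw [timeRate_ratio _ (by linarith) hx, midKappa_eq, div_eq_one_iff_eq hx.ne']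
  have e : 1 / midSigma x + 2 / (1 - midSigma x)
      + 2 / (2 * midSigma x / midDen x * (1 - midSigma x))
      = (1 - midSigma x + 2 * midSigma x + midDen x) / (midSigma x * (1 - midSigma x)) := by
    field_simp
  rw [e, div_eq_iff (by positivity), midDen]
  ring

lemma energyRate_mid {x : ℝ} (h1 : 9.06 ≤ x) (h2 : x ≤ 11.46) :
    energyRate (midSigma x * x) x (midKappa x * x) = midRatio x := by
  obtain ⟨hu0, hu1⟩ := midSigma_bounds h1 h2
  rw [energyRate_ratio _ (by linarith) (by linarith), midRatio]
  ring

/-- Near-optimality among the speeds with chase speed exactly `x`. -/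
lemma midRatio_le_of_r_eq {x : ℝ} (h1 : 9.06 ≤ x) (h2 : x ≤ 11.46) {v : Speeds} (hv : Valid v)
    (hr : v.r = x) (ht : timeRate v.s v.r v.k ≤ 1) :
    midRatio x ≤ energyRate v.s v.r v.k + 0.03 := by
  have hx : 0 < x := by linarith
  obtain ⟨s, r, k⟩ := v
  obtain ⟨hs, hsr, hk⟩ := hv
  dsimp only at *
  subst hr
  obtain ⟨u, rfl⟩ : ∃ u, s = u * r := ⟨s / r, by field_simp⟩
  obtain ⟨q, rfl⟩ : ∃ q, k = q * r := ⟨k / r, by field_simp⟩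
  have hu0 : 0 < u := pos_of_mul_pos_left hs hx.le
  have hq0 : 0 < q := pos_of_mul_pos_left hk hx.le
  have hu1 : u < 1 := by
    by_contra! h
    nlinarith
  have hd : 0 < 1 - u := by linarith
  rw [timeRate_ratio q hu1 hx, div_le_one hx] at ht
  rw [energyRate_ratio q hu1 hx]
  obtain ⟨a, v, n, M, ha, hM, hB, hC⟩ := midCertificate h1 h2
  -- The time constraint bounds `1 / q` in terms of `u`.
  have hq : 1 / q ≤ (r - r * u - 1 / u - 1) / 2 := by
    have h := mul_le_mul_of_nonneg_left ht (half_pos hd).le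
    have e : (1 - u) / 2 * (1 / u + 2 / (1 - u) + 2 / (q * (1 - u)))
        = 1 / u / 2 - 1 / 2 + 1 + 1 / q := by
      field_simp
    rw [e] at h
    linarith
  -- `q ^ 2` is convex in `1 / q` and lies above its tangent at `1 / a`.
  have hq2 : 3 * a ^ 2 - 2 * a ^ 3 * (1 / q) ≤ q ^ 2 := by
    have e : q ^ 2 - (3 * a ^ 2 - 2 * a ^ 3 * (1 / q)) = (q - a) ^ 2 * (q + 2 * a) / q := by
      field_simp
      ring
    have : 0 ≤ (q - a) ^ 2 * (q + 2 * a) / q := by positivity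
    linarith
  -- `1 / u` lies above its tangent at `1 / n`.
  have hn : 2 * n - n ^ 2 * u ≤ 1 / u := by
    have e : 1 / u - (2 * n - n ^ 2 * u) = (1 - n * u) ^ 2 / u := by
      field_simp
      ring
    have : 0 ≤ (1 - n * u) ^ 2 / u := by positivity
    linarith
  have ha3 : 0 ≤ a ^ 3 := by positivity
  have hlow : M * (1 - u) ≤ u ^ 2 + 1 + 2 * q ^ 2 := by
    have h3 := mul_le_mul_of_nonneg_left hq ha3
    have h4 := mul_le_mul_of_nonneg_left hn ha3
    set B := 2 * v + 2 * a ^ 3 * r - 2 * a ^ 3 * n ^ 2 + M with hBdef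
    -- The slope `B` in `u` is absorbed by the square that the tangent of `u ^ 2` at `v` leaves.
    have h5 : 0 ≤ (u - v) ^ 2 + B * (u - v) + 0.005 ^ 2 / 4 := by
      have := neg_abs_le (B * (u - v))
      rw [abs_mul] at this
      nlinarith [mul_le_mul_of_nonneg_right hB (abs_nonneg (u - v)), sq_abs (u - v),
        sq_nonneg (|u - v| - 0.005 / 2)]
    have h6 : (u - v) ^ 2 + B * (u - v) + (1 + 6 * a ^ 2 - v ^ 2 - 2 * a ^ 3 * (r - 1)
        + 4 * a ^ 3 * n - M + B * v) = u ^ 2 + 1 + 6 * a ^ 2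
        - 2 * a ^ 3 * (r - r * u - (2 * n - n ^ 2 * u) - 1) - M * (1 - u) := by
      rw [hBdef]
      ring
    linarith
  obtain ⟨hU0, hU1⟩ := midSigma_bounds h1 h2
  have hD := midDen_pos h1 h2
  have h1U : 0 < 1 - midSigma r := by linarith
  have hup : midRatio r ≤ r ^ 2 * M + 0.03 := by
    have e : r ^ 2 * M + 0.03 - midRatio r = (M * ((1 - midSigma r) * midDen r ^ 2 * r ^ 2)
        - ((midSigma r ^ 2 + 1) * midDen r ^ 2 + 8 * midSigma r ^ 2) * r ^ 2
        + 0.03 * (1 - midSigma r) * midDen r ^ 2) / ((1 - midSigma r) * midDen r ^ 2) := by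
      rw [midRatio, midKappa_eq]
      field_simp
      ring
    have := div_nonneg hM (show 0 ≤ (1 - midSigma r) * midDen r ^ 2 by positivity)
    linarith
  have hlow' : r ^ 2 * M ≤ r ^ 2 * (u ^ 2 + 1 + 2 * q ^ 2) / (1 - u) := by
    rw [mul_div_assoc]
    exact mul_le_mul_of_nonneg_left ((le_div_iff₀ hd).2 hlow) (by positivity)
  linarith

/-- A chase speed below the bound `x` does not help: moving geometrically towards the globally
optimal speeds raises the chase speed to `x` without raising the energy. -/
lemma RatioSystem.midRatio_le {u q r : ℝ} (h : RatioSystem u q r) {x : ℝ} (h1 : 9.06 ≤ x)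
    (h2 : x ≤ 11.46) (hxr : x < r) {v : Speeds} (hv : Valid v) (hr : v.r ≤ x)
    (ht : timeRate v.s v.r v.k ≤ 1) : midRatio x ≤ energyRate v.s v.r v.k + 0.03 := by
  have hE := h.energyRate_le hv ht
  obtain ⟨⟨hu0, hu1, hq, hr0⟩, -, -, hT⟩ := h
  have hw : Valid ⟨u * r, r, q * r⟩ := ⟨by positivity, by nlinarith, by positivity⟩
  have hwt : timeRate (u * r) r (q * r) ≤ 1 := by
    rw [timeRate_ratio q hu1 hr0, ← hT, div_self hr0.ne']
  obtain ⟨z, hz, hzr, hzt, hzE⟩ := exists_interpolation hv hw ht hwt hE hr hxr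
  have := midRatio_le_of_r_eq h1 h2 hz hzr hzt
  linarith

/-- Clearing denominators turns the comparison into two polynomial inequalities. -/
lemma abs_midRatio_sub_midRatioRounded_le {x : ℝ} (hx1 : 9.06 ≤ x) (hx2 : x ≤ 11.46) :
    |midRatio x - midRatioRounded x| ≤ 0.001 := by
  obtain ⟨hU0, hU1⟩ := midSigma_bounds hx1 hx2
  have hD := midDen_pos hx1 hx2
  have h1U : 0 < 1 - midSigma x := by linarith
  have hP : x * (x * (x - 2.46798) - 398.916) + 2221.18 < 0 := by
    obtain ⟨y, rfl⟩ : ∃ y, x = 9.06 + y := ⟨x - 9.06, by ring⟩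
    have hy0 : 0 ≤ y := by linarith
    have hy1 : 0 ≤ 2.4 - y := by linarith
    nlinarith [mul_nonneg hy0 hy1, mul_nonneg (mul_nonneg hy0 hy0) hy1]
  set P := x * (x * (x - 2.46798) - 398.916) + 2221.18 with hPdef
  have hPne : P ≠ 0 := hP.ne
  have e : midRatio x - midRatioRounded x
      = (8 * midSigma x ^ 2 * P ^ 2 - 11595.8 * (20.2699 - x) ^ 2 * midDen x ^ 2) * x ^ 2
        / ((1 - midSigma x) * midDen x ^ 2 * P ^ 2) := by
    have hs : (0.0262661 : ℝ) * x + 0.467588 = 1 - midSigma x := by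
      rw [midSigma]
      ring
    rw [midRatio, midKappa_eq, midRatioRounded, hs, ← hPdef, ← midSigma]
    field_simp
    ring
  have hpos : 0 < (1 - midSigma x) * midDen x ^ 2 * P ^ 2 := by positivity
  obtain ⟨t, h0, h1, rfl⟩ : ∃ t : ℝ, 0 ≤ t ∧ t ≤ 1 ∧ x = 9.06 + 2.4 * t :=
    ⟨(x - 9.06) / 2.4, div_nonneg (sub_nonneg.2 hx1) (by norm_num),
      (div_le_one (by norm_num)).2 (by linarith), by ring⟩
  rw [e, abs_le, le_div_iff₀ hpos, div_le_iff₀ hpos, hPdef]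
  clear_value P
  constructor
  · have h : ∀ s : ℝ, 0 ≤ s → 0 ≤
        297.3219492607329069185707191743777249679720293184788465372769075951181824 * s ^ 13
          + 4380.5790149381805469097542462797618270220769767476884016259890476783542272 * t * s ^ 12
          + 29646.4220440401360871016434809090074575589307020898731090105458075111636992 * t ^ 2 * s ^ 11
          + 121962.0948502640788777220603586040129510318140492572356265389419284645658624 * t ^ 3 * s ^ 10
          + 340110.332034769516971899146218155184194374432433449413057155402059999604736 * t ^ 4 * s ^ 9
          + 678622.4819802511960559021410283144051757223470006231897757538544210498674688 * t ^ 5 * s ^ 8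
          + 996366.1302398611099533631044951318889618594830886951067177961286029955989504 * t ^ 6 * s ^ 7
          + 1089558.2769351298343831268080516457368496399192472557990764034290078419943424 * t ^ 7 * s ^ 6
          + 887183.7482318534013286120148526341217728891572181088657974749236178391851008 * t ^ 8 * s ^ 5
          + 531165.139116902918439451766064284576373961642354830737457225407801720795136 * t ^ 9 * s ^ 4
          + 227250.2108342356141441763725783860947662676520553583763050656495767510564864 * t ^ 10 * s ^ 3
          + 65786.1612033614732447475319023957093728276780605643961315417892520437727232 * t ^ 11 * s ^ 2
          + 11549.1915876600195612659532809166546719246354516925022624846177214334738432 * t ^ 12 * s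
          + 928.6238219286312716103331539617360916319280805087706504351328353258512384 * t ^ 13 :=
      fun s hs => by positivity
    simp only [midDen, midSigma]
    linear_combination h (1 - t) (sub_nonneg.2 h1)
  · have h : ∀ s : ℝ, 0 ≤ s → 0 ≤
        56.4340022050634909778702076800250868429292735546212234972769075951181824 * s ^ 13
          + 1036.7191200738972084196333540006143845697001853758551293059890476783542272 * t * s ^ 12
          + 8258.4002555939250726169790884289724082116370300731954462905458075111636992 * t ^ 2 * s ^ 11
          + 38486.9241361314690406794294010852760989112366438077377602989419284645658624 * t ^ 3 * s ^ 10
          + 118304.609982807903889123434492420355896243791221525338407555402059999604736 * t ^ 4 * s ^ 9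
          + 254923.9084305254532156163220700330402529184544449222405072738544210498674688 * t ^ 5 * s ^ 8
          + 397835.4253275523454770186141549527549249153217937942941635561286029955989504 * t ^ 6 * s ^ 7
          + 456604.9366027353410554261699750114136008497816071293543685634290078419943424 * t ^ 7 * s ^ 6
          + 386218.1965215297621291473315749083540283591643569279350633949236178391851008 * t ^ 8 * s ^ 5
          + 238156.417149181957286998492318597377701373925350717550487625407801720795136 * t ^ 9 * s ^ 4
          + 104187.1246238922461097185587452479644666972411275556232196256495767510564864 * t ^ 10 * s ^ 3
          + 30650.0615866831412890346733068297221856017685946356843696217892520437727232 * t ^ 11 * s ^ 2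
          + 5438.6812326453026658791114660594813029075699441079665773646177214334738432 * t ^ 12 * s
          + 439.9049219910716044407684843190729819479307120257525025951328353258512384 * t ^ 13 :=
      fun s hs => by positivity
    simp only [midDen, midSigma]
    linear_combination h (1 - t) (sub_nonneg.2 h1)

/-! ### Normalization to `c = 1` -/

/-- Speeds multiplied by `c`. This changes the bounds `c` and `b` on the search time and the speeds
to `1` and `c * b`. -/
noncomputable def scale (c : ℝ) (v : Speeds) : Speeds := ⟨c * v.s, c * v.r, c * v.k⟩

lemma feasible_iff_scale {c b : ℝ} (hc : 0 < c) {v : Speeds} :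
    Feasible c b v ↔ Valid (scale c v) ∧
      ((scale c v).s ≤ c * b ∧ (scale c v).r ≤ c * b ∧ (scale c v).k ≤ c * b) ∧
      timeRate (scale c v).s (scale c v).r (scale c v).k ≤ 1 := by
  simp only [feasible_iff, Valid, scale, timeRate_scale hc, div_le_one hc,
    mul_le_mul_iff_right₀ hc, mul_lt_mul_iff_right₀ hc, mul_pos_iff_of_pos_left hc]

lemma energy_eq_scale {c : ℝ} (hc : 0 < c) {v : Speeds} (hv : Valid v) {p : ℝ} (hp : p ≠ 0) :
    energy v p = energyRate (scale c v).s (scale c v).r (scale c v).k * (2 * |p| / c ^ 2) := by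
  rw [energy_eq hv hp]
  simp only [scale, energyRate_scale hc]
  field_simp

lemma competitiveRatio_eq_scale {c : ℝ} (hc : 0 < c) {v : Speeds} (hv : Valid v) :
    competitiveRatio c v
      = ((energyRate (scale c v).s (scale c v).r (scale c v).k : ℝ) : EReal) := by
  rw [competitiveRatio_eq hv]
  simp only [scale, energyRate_scale hc]

lemma scale_lowSpeeds {c : ℝ} (hc : 0 < c) (b : ℝ) :
    scale c (lowSpeeds c b) = ⟨lowS (c * b), c * b, c * b⟩ := by
  simp only [scale, lowSpeeds, lowS, mul_comm b c, Speeds.mk.injEq, and_true]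
  field_simp
  ring

lemma scale_midSpeeds {c b : ℝ} (hc : 0 < c) (hb : 0 < b) (h1 : 9.06 ≤ c * b)
    (h2 : c * b ≤ 11.46) :
    scale c (midSpeeds c b)
      = ⟨midSigma (c * b) * (c * b), c * b, midKappa (c * b) * (c * b)⟩ := by
  have hs : midS c b = b * midSigma (c * b) := by
    rw [midS, midSigma]
    ring
  have hD := midDen_pos h1 h2
  have hden : b * c * midS c b - b - c * midS c b ^ 2 - midS c b = b * midDen (c * b) := by
    rw [hs, midDen]
    ring
  simp only [scale, midSpeeds, hden, midKappa_eq, Speeds.mk.injEq, true_and]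
  rw [hs]
  refine ⟨by ring, ?_⟩
  field_simp

lemma scale_highSpeeds {c : ℝ} (hc : 0 < c) (w : Speeds) : scale c (highSpeeds w c) = w := by
  ext <;> simp only [scale, highSpeeds] <;> field_simp

/-- The chosen speeds are legitimate, respect the speed bounds, meet the time constraint with
equality, and have the announced energy. -/
lemma chosenSpeeds_spec {u q r : ℝ} (h : RatioSystem u q r) (hr : r ≤ 11.3415) (hqr : q < 1)
    {c b : ℝ} (hc : 0 < c) (hb : 0 < b) (hcb : 9 ≤ c * b) :
    Valid (scale c (chosenSpeeds ⟨u * r, r, q * r⟩ c b)) ∧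
      ((scale c (chosenSpeeds ⟨u * r, r, q * r⟩ c b)).s ≤ c * b ∧
        (scale c (chosenSpeeds ⟨u * r, r, q * r⟩ c b)).r ≤ c * b ∧
        (scale c (chosenSpeeds ⟨u * r, r, q * r⟩ c b)).k ≤ c * b) ∧
      timeRate (scale c (chosenSpeeds ⟨u * r, r, q * r⟩ c b)).s
        (scale c (chosenSpeeds ⟨u * r, r, q * r⟩ c b)).r
        (scale c (chosenSpeeds ⟨u * r, r, q * r⟩ c b)).k = 1 ∧
      energyRate (scale c (chosenSpeeds ⟨u * r, r, q * r⟩ c b)).s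
        (scale c (chosenSpeeds ⟨u * r, r, q * r⟩ c b)).r
        (scale c (chosenSpeeds ⟨u * r, r, q * r⟩ c b)).k
          = ratioFun ⟨u * r, r, q * r⟩ (c * b) := by
  have hx : 0 < c * b := by linarith
  have hg := gamma1_bounds
  rw [chosenSpeeds, ratioFun]
  split_ifs with h1 h2
  · rw [scale_lowSpeeds hc]
    obtain ⟨k1, k2, -⟩ := lowS_spec hcb
    refine ⟨⟨k1, ?_, hx⟩, ⟨?_, le_rfl, le_rfl⟩, timeRate_lowS hcb, energyRate_lowS hcb⟩
    · change lowS (c * b) < c * b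
      linarith
    · change lowS (c * b) ≤ c * b
      linarith
  · have hx1 : 9.066092 ≤ c * b := by linarith
    have hx2 : c * b ≤ 11.46 := by
      change c * b < r at h2
      linarith
    rw [scale_midSpeeds hc hb (by linarith) hx2]
    obtain ⟨k1, k2⟩ := midSigma_bounds (x := c * b) (by linarith) hx2
    have hD := midDen_pos (x := c * b) (by linarith) hx2
    have hk : midKappa (c * b) ≤ 1 := by
      rw [midKappa_eq, div_le_one hD]
      exact two_mul_midSigma_le hx1 hx2
    have hk0 : 0 < midKappa (c * b) := by
      rw [midKappa_eq]
      exact div_pos (by linarith) hD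
    refine ⟨⟨mul_pos (by linarith) hx, ?_, mul_pos hk0 hx⟩, ⟨?_, le_rfl, ?_⟩,
      timeRate_mid (by linarith) hx2, energyRate_mid (by linarith) hx2⟩
    · exact mul_lt_of_lt_one_left hx (by linarith)
    · exact mul_le_of_le_one_left hx.le (by linarith)
    · exact mul_le_of_le_one_left hx.le hk
  · rw [scale_highSpeeds hc]
    obtain ⟨⟨hu0, hu1, hq, hr0⟩, -, -, hT⟩ := h
    have h2' : r ≤ c * b := not_lt.1 h2
    refine ⟨⟨by positivity, ?_, by positivity⟩, ⟨?_, h2', ?_⟩, ?_, ?_⟩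
    · exact mul_lt_of_lt_one_left hr0 hu1
    · exact (mul_le_of_le_one_left hr0.le hu1.le).trans h2'
    · exact (mul_le_of_le_one_left hr0.le hqr.le).trans h2'
    · change timeRate (u * r) r (q * r) = 1
      rw [timeRate_ratio q hu1 hr0, ← hT, div_self hr0.ne']
    · rw [energyRate, highRatio]
      ring

/-- In the two outer regimes no feasible speeds have less energy than the chosen ones. -/
lemma energyRate_chosenSpeeds_le {u q r : ℝ} (h : RatioSystem u q r) (hrg : gamma1 < r)
    {c b : ℝ} (hc : 0 < c) (hcb : 9 ≤ c * b) (hout : c * b ≤ gamma1 ∨ r ≤ c * b)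
    {z : Speeds} (hz : Valid z) (hzr : z.r ≤ c * b) (hzk : z.k ≤ c * b)
    (ht : timeRate z.s z.r z.k ≤ 1) :
    energyRate (scale c (chosenSpeeds ⟨u * r, r, q * r⟩ c b)).s
        (scale c (chosenSpeeds ⟨u * r, r, q * r⟩ c b)).r
        (scale c (chosenSpeeds ⟨u * r, r, q * r⟩ c b)).k ≤ energyRate z.s z.r z.k := by
  rcases hout with h1 | h1
  · rw [chosenSpeeds, if_pos h1, scale_lowSpeeds hc]
    exact energyRate_lowS_le hcb h1 hz ht hzr hzk
  · rw [chosenSpeeds, if_neg (by linarith), if_neg (not_lt.2 h1), scale_highSpeeds hc]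
    exact h.energyRate_le hz ht

end TwoTurn

theorem mainTheorem2 :
    |TwoTurn.gamma1 - 9.06609| ≤ 0.000005 ∧
    ∃ w : TwoTurn.Speeds,
      -- `w = (σ, ρ, κ)` is the unique positive solution of the system, and `γ₂ = ρ`
      (TwoTurn.SigmaRhoKappaSystem w ∧
        ∀ w' : TwoTurn.Speeds, TwoTurn.SigmaRhoKappaSystem w' → w' = w) ∧
      (|w.s - 2.65976| ≤ 0.000005 ∧ |w.r - 11.3414| ≤ 0.00005 ∧ |w.k - 6.63709| ≤ 0.000005) ∧
      -- numerical form of the competitive ratio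
      (∀ x : ℝ, TwoTurn.gamma1 < x → x < w.r →
        |TwoTurn.midRatio x - TwoTurn.midRatioRounded x| ≤ 0.001) ∧
      |TwoTurn.highRatio w - 292.370| ≤ 0.0005 ∧
      ∀ c b : ℝ, 0 < c → 0 < b → 9 ≤ c * b →
        -- feasibility
        TwoTurn.Feasible c b (TwoTurn.chosenSpeeds w c b) ∧
        -- competitive ratio and energy
        TwoTurn.competitiveRatio c (TwoTurn.chosenSpeeds w c b)
          = ((TwoTurn.ratioFun w (c * b) : ℝ) : EReal) ∧
        (∀ p : ℝ, p ≠ 0 →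
          TwoTurn.energy (TwoTurn.chosenSpeeds w c b) p
            = TwoTurn.ratioFun w (c * b) * (2 * |p| / c ^ 2)) ∧
        -- optimality in the two outer regimes
        (c * b ≤ TwoTurn.gamma1 ∨ w.r ≤ c * b →
          TwoTurn.Optimal c b (TwoTurn.chosenSpeeds w c b)) ∧
        -- near-optimality in the middle regime
        (TwoTurn.gamma1 < c * b → c * b < w.r →
          ∀ v : TwoTurn.Speeds, TwoTurn.Feasible c b v →
            TwoTurn.competitiveRatio c (TwoTurn.chosenSpeeds w c b)
              ≤ TwoTurn.competitiveRatio c v + ((0.03 : ℝ) : EReal)) := by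
  obtain ⟨u, q, r, h, hu, hq⟩ := TwoTurn.exists_ratioSystem_bounds
  obtain ⟨hr, hs, hk⟩ := h.bounds hu hq
  obtain ⟨hg1, hg2⟩ := TwoTurn.gamma1_bounds
  obtain ⟨hE1, hE2⟩ := TwoTurn.energyRate_bounds hr hs hk
  have hrg : TwoTurn.gamma1 < r := by linarith [hr.1]
  refine ⟨abs_le.2 ⟨by linarith, by linarith⟩, ⟨u * r, r, q * r⟩, ⟨h.system, ?_⟩,
    ⟨abs_le.2 ⟨?_, ?_⟩, abs_le.2 ⟨?_, ?_⟩, abs_le.2 ⟨?_, ?_⟩⟩, ?_, ?_, ?_⟩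
  · intro w' hw'
    obtain ⟨u', q', r', h', rfl⟩ := TwoTurn.exists_ratioSystem hw'
    obtain ⟨rfl, rfl, rfl⟩ := h.unique h'
    rfl
  · linarith [hs.1]
  · linarith [hs.2]
  · linarith [hr.1]
  · linarith [hr.2]
  · linarith [hk.1]
  · linarith [hk.2]
  · intro x hx1 hx2
    refine TwoTurn.abs_midRatio_sub_midRatioRounded_le (by linarith) ?_
    change x < r at hx2
    linarith [hr.2]
  · have e : TwoTurn.highRatio ⟨u * r, r, q * r⟩ = TwoTurn.energyRate (u * r) r (q * r) := by
      rw [TwoTurn.highRatio, TwoTurn.energyRate]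
      ring
    rw [e]
    exact abs_le.2 ⟨by linarith, by linarith⟩
  · intro c b hc hb hcb
    obtain ⟨hv, hbd, ht, he⟩ := TwoTurn.chosenSpeeds_spec h (by linarith [hr.2])
      (by linarith [hq.2]) hc hb hcb
    have hf : TwoTurn.Feasible c b (TwoTurn.chosenSpeeds ⟨u * r, r, q * r⟩ c b) :=
      (TwoTurn.feasible_iff_scale hc).2 ⟨hv, hbd, ht.le⟩
    have hv' : TwoTurn.Valid (TwoTurn.chosenSpeeds ⟨u * r, r, q * r⟩ c b) := hf.1
    refine ⟨hf, ?_, ?_, ?_, ?_⟩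
    · rw [TwoTurn.competitiveRatio_eq_scale hc hv', he]
    · intro p hp
      rw [TwoTurn.energy_eq_scale hc hv' hp, he]
    · intro hout
      refine ⟨hf, fun v hfv p hp => ?_⟩
      have hvv : TwoTurn.Valid v := hfv.1
      obtain ⟨k1, ⟨-, k2, k3⟩, k4⟩ := (TwoTurn.feasible_iff_scale hc).1 hfv
      rw [TwoTurn.energy_eq_scale hc hv' hp, TwoTurn.energy_eq_scale hc hvv hp]
      exact mul_le_mul_of_nonneg_right
        (TwoTurn.energyRate_chosenSpeeds_le h hrg hc hcb hout k1 k2 k3 k4) (by positivity)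
    · intro hx1 hx2 v hfv
      have hvv : TwoTurn.Valid v := hfv.1
      obtain ⟨k1, ⟨-, k2, -⟩, k4⟩ := (TwoTurn.feasible_iff_scale hc).1 hfv
      rw [TwoTurn.competitiveRatio_eq_scale hc hv', he,
        TwoTurn.competitiveRatio_eq_scale hc hvv, ← EReal.coe_add, EReal.coe_le_coe_iff,
        TwoTurn.ratioFun, if_neg (not_le.2 hx1), if_pos hx2]
      change c * b < r at hx2
      exact h.midRatio_le (by linarith) (by linarith [hr.2]) hx2 k1 k2 k4
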